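/- Let $(M,g)$ be a smooth Lorentzian manifold of dimension $m+2$, $m\ge 0$, of signature $(-,+,\dots,+)$, and let $\gamma:I\to M$ be an affinely parametrized null geodesic with nowhere vanishing velocity, defined on a nonempty open interval $I\subseteq\mathbb R$. *Homogeneous geodesics.* A geodesic $\gamma:I\to M$ of $g$ is called homogeneous if, up to a change of parameter, it is the orbit of a one-parameter group of isometries: there are a smooth one-parameter group $(\varphi_s)_{s\in\mathbb R}$ of isometries of $(M,g)$ and a diffeomorphism $\tau:\mathbb R\to I$ with $\gamma(\tau(s))=\varphi_s(\gamma(\tau(0)))$ for all $s\in\mathbb R$. It is called absolutely homogeneous if no change of parameter is needed, i.e. if $I=\mathbb R$ and $\gamma(t)=\varphi_t(\gamma(0))$ for all $t\in\mathbb R$, for some such group $(\varphi_t)$. *Penrose limit.* Adapted coordinates along a piece of $\gamma$ are coordinates $\mu=(u,v,y^1,\dots,y^m)$ on an open subset of $M$ in which $\gamma$ is the curve $u\mapsto(u,0,0)$ and $$g=du\,dv+\alpha\,dv^2+\sum_i\beta_i\,dy^i dv+\sum_{i,j}C_{ij}\,dy^i dy^j,$$ with $\alpha,\beta_i,C_{ij}$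 functions of $(u,v,y)$ and $(C_{ij})$ positive definite. Put $\psi_\Omega(u,v,y)=(u,\Omega^2v,\Omega y)$. If $J\subseteq I$ is the set of parameters of $\gamma$ covered by the coordinates, the limit metric on the patch $J\times\mathbb R\times\mathbb R^m$ is $$g_{Pl}=\lim_{\Omega\to0^+}\Omega^{-2}\,\psi_\Omega^*(\mu^{-1})^*g=du\,dv+\sum_{i,j}C_{ij}(u,0,0)\,dy^i dy^j .$$ A Penrose limit of $g$ along $\gamma$ is a Lorentzian manifold $(N,g_{Pl})$ obtained from any family of adapted coordinate systems $\mu_a$ covering $\gamma$ by gluing their patches, over the common values of $u$ (and nowhere else), by the limits $\lim_{\Omega\to0^+}\psi_\Omega^{-1}\circ(\mu_b\circ\mu_a^{-1})\circ\psi_\Omega$ of the rescaled coordinate changes. The curves $u\mapsto(u,0,0)$ of the patches fit together to a curve $I\to N$, again denoted $\gamma$. Then, for every Penrose limit $(N,g_{Pl})$ of $g$ along $\gamma$: 1. if $\gamma:I\to M$ is a homogeneous geodesic of $g$, then $\gamma:I\to N$ is a homogeneous geodesic of $g_{Pl}$; 2. if $\gamma:I\to M$ is an absolutely homogeneous geodesic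 of $g$, then $\gamma:I\to N$ is an absolutely homogeneous geodesic of $g_{Pl}$. -/

import Mathlib

open Set Filter Topology
open scoped Manifold ContDiff

-- These two instances see through `TopCat.of` and would be found, instead of `chartedSpaceSelf`,
-- for a model space as a manifold over itself.
attribute [-instance] TopCat.of.chartedSpace TopCat.of.hasGroupoid

noncomputable section

/-- The model space `ℝ^{m+2}` of the spacetimes. -/
abbrev SpacetimeModel (m : ℕ) : Type := EuclideanSpace ℝ (Fin (m + 2))

/-- The space `ℝ^{m+2}` in which adapted coordinates `(u, v, y)`, `y = (y¹, …, yᵐ)`,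
take their values. -/
abbrev CoordSpace (m : ℕ) : Type := ℝ × ℝ × EuclideanSpace ℝ (Fin m)

section Lorentz

variable {m : ℕ} {M : Type*} [TopologicalSpace M] [ChartedSpace (SpacetimeModel m) M]

/-- A smooth Lorentzian metric on a smooth `(m+2)`-manifold, in the convention `(-, +, …, +)`:
a smooth field of symmetric bilinear forms such that every tangent space has a vector `T` with
`g(T, T) < 0` on whose orthogonal complement `g` is positive definite. -/
structure LorentzMetric (m : ℕ) (M : Type*) [TopologicalSpace M]
    [ChartedSpace (SpacetimeModel m) M] [IsManifold 𝓘(ℝ, SpacetimeModel m) ∞ M] where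
  /-- The bilinear form on each tangent space. -/
  val (x : M) : TangentSpace 𝓘(ℝ, SpacetimeModel m) x →L[ℝ]
    TangentSpace 𝓘(ℝ, SpacetimeModel m) x →L[ℝ] ℝ
  symm (x : M) (X Y : TangentSpace 𝓘(ℝ, SpacetimeModel m) x) : val x X Y = val x Y X
  lorentzian (x : M) : ∃ T : TangentSpace 𝓘(ℝ, SpacetimeModel m) x, val x T T < 0 ∧
    ∀ X : TangentSpace 𝓘(ℝ, SpacetimeModel m) x, val x T X = 0 → X ≠ 0 → 0 < val x X X
  contMDiff : ContMDiff 𝓘(ℝ, SpacetimeModel m)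
    (𝓘(ℝ, SpacetimeModel m).prod
      𝓘(ℝ, SpacetimeModel m →L[ℝ] SpacetimeModel m →L[ℝ] ℝ)) ∞
    (fun x ↦ Bundle.TotalSpace.mk' (SpacetimeModel m →L[ℝ] SpacetimeModel m →L[ℝ] ℝ)
      (E := fun x : M ↦ TangentSpace 𝓘(ℝ, SpacetimeModel m) x →L[ℝ]
        TangentSpace 𝓘(ℝ, SpacetimeModel m) x →L[ℝ] ℝ) x (val x))

variable [IsManifold 𝓘(ℝ, SpacetimeModel m) ∞ M]

/-- The pullback `(f^* g)_x (X, Y)` of a metric by a map `f : F → M` from a normed space. -/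
def LorentzMetric.pullback (g : LorentzMetric m M) {F : Type*} [NormedAddCommGroup F]
    [NormedSpace ℝ F] (f : F → M) (x X Y : F) : ℝ :=
  g.val (f x) (mfderiv 𝓘(ℝ, F) 𝓘(ℝ, SpacetimeModel m) f x X)
    (mfderiv 𝓘(ℝ, F) 𝓘(ℝ, SpacetimeModel m) f x Y)

/-- The metric in the preferred chart of the manifold at `p`. -/
def LorentzMetric.inChart (g : LorentzMetric m M) (p : M) (x X Y : SpacetimeModel m) : ℝ :=
  g.pullback (chartAt (SpacetimeModel m) p).symm x X Y

/-- The Christoffel symbols of the first kind of the Levi-Civita connection in the preferred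
chart at `p`: `g(∇_X Y, Z) = (X g(Y, Z) + Y g(X, Z) - Z g(X, Y)) / 2` for constant vector
fields `X`, `Y`, `Z` of the chart. -/
def LorentzMetric.christoffel (g : LorentzMetric m M) (p : M) (x X Y Z : SpacetimeModel m) : ℝ :=
  (fderiv ℝ (fun x' ↦ g.inChart p x' Y Z) x X + fderiv ℝ (fun x' ↦ g.inChart p x' X Z) x Y
    - fderiv ℝ (fun x' ↦ g.inChart p x' X Y) x Z) / 2

/-- The velocity of a curve. -/
def velocity (γ : ℝ → M) (t : ℝ) : TangentSpace 𝓘(ℝ, SpacetimeModel m) (γ t) :=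
  mfderiv 𝓘(ℝ, ℝ) 𝓘(ℝ, SpacetimeModel m) γ t (1 : ℝ)

/-- `γ` is a (nonconstant, affinely parameterized) geodesic on the nonempty open interval `I`:
it is smooth with nowhere vanishing velocity, and `∇_{γ'} γ' = 0`. The last equation is
written at each time `t` in the chart at `γ t`, with its index lowered. -/
structure IsGeodesicOn (g : LorentzMetric m M) (γ : ℝ → M) (I : Set ℝ) : Prop where
  isOpen : IsOpen I
  ordConnected : I.OrdConnected
  nonempty : I.Nonempty
  smooth : ContMDiffOn 𝓘(ℝ, ℝ) 𝓘(ℝ, SpacetimeModel m) ∞ γ I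
  velocity_ne_zero : ∀ t ∈ I, velocity (m := m) γ t ≠ 0
  geodesic_eq : ∀ t ∈ I, ∀ Z : SpacetimeModel m,
    let c : ℝ → SpacetimeModel m := fun s ↦ chartAt (SpacetimeModel m) (γ t) (γ s)
    g.inChart (γ t) (c t) (deriv (deriv c) t) Z +
      g.christoffel (γ t) (c t) (deriv c t) (deriv c t) Z = 0

/-- Null geodesics. -/
structure IsNullGeodesicOn (g : LorentzMetric m M) (γ : ℝ → M) (I : Set ℝ) : Prop extends
    IsGeodesicOn g γ I where
  null : ∀ t ∈ I, g.val (γ t) (velocity γ t) (velocity γ t) = 0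

/-- `φ` is a (smooth) one-parameter group of isometries of `g`. -/
structure IsOneParameterIsometryGroup (g : LorentzMetric m M) (φ : ℝ → M → M) : Prop where
  smooth : ContMDiff (𝓘(ℝ, ℝ).prod 𝓘(ℝ, SpacetimeModel m)) 𝓘(ℝ, SpacetimeModel m) ∞
    (fun q : ℝ × M ↦ φ q.1 q.2)
  zero : ∀ x, φ 0 x = x
  add : ∀ s t x, φ (s + t) x = φ s (φ t x)
  isometry : ∀ s x, ∀ X Y : TangentSpace 𝓘(ℝ, SpacetimeModel m) x,
    g.val (φ s x)
      (mfderiv 𝓘(ℝ, SpacetimeModel m) 𝓘(ℝ, SpacetimeModel m) (φ s) x X)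
      (mfderiv 𝓘(ℝ, SpacetimeModel m) 𝓘(ℝ, SpacetimeModel m) (φ s) x Y) = g.val x X Y

/-- A homogeneous geodesic `γ : I → M`: after a change of parameter `t = τ(s)`, where `τ` is a
diffeomorphism from `ℝ` onto `I`, it is the orbit of a one-parameter group of isometries. -/
def IsHomogeneousGeodesic (g : LorentzMetric m M) (γ : ℝ → M) (I : Set ℝ) : Prop :=
  IsGeodesicOn g γ I ∧ ∃ φ : ℝ → M → M, IsOneParameterIsometryGroup g φ ∧
    ∃ τ : ℝ → ℝ, ContDiff ℝ ∞ τ ∧ (∀ s, deriv τ s ≠ 0) ∧ range τ = I ∧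
      ∀ s, γ (τ s) = φ s (γ (τ 0))

/-- An absolutely homogeneous geodesic: in its affine parameter, it is the orbit of a
one-parameter group of isometries. -/
def IsAbsolutelyHomogeneousGeodesic (g : LorentzMetric m M) (γ : ℝ → M) (I : Set ℝ) : Prop :=
  IsGeodesicOn g γ I ∧ I = univ ∧ ∃ φ : ℝ → M → M, IsOneParameterIsometryGroup g φ ∧
    ∀ t, γ t = φ t (γ 0)

/-- Adapted coordinates `(u, v, y)` along a piece of the null geodesic `γ : I → M`: `γ` is the
curve `u ↦ (u, 0, 0)`, and `g = du dv + α dv² + ∑ βᵢ dyⁱ dv + ∑ Cᵢⱼ dyⁱ dyʲ` with `(Cᵢⱼ)`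
positive definite (an equality of quadratic forms; products of one-forms are symmetric
products). -/
structure AdaptedChart (g : LorentzMetric m M) (γ : ℝ → M) (I : Set ℝ) where
  /-- The coordinate map, a diffeomorphism of an open subset of `M` with one of `ℝ^{m+2}`. -/
  coord : PartialDiffeomorph 𝓘(ℝ, SpacetimeModel m) 𝓘(ℝ, CoordSpace m) M (CoordSpace m) ∞
  /-- The coefficient of `dv²`. -/
  α : CoordSpace m → ℝ
  /-- The coefficients of `dyⁱ dv`. -/
  β : CoordSpace m → Fin m → ℝ
  /-- The coefficients of `dyⁱ dyʲ`. -/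
  C : CoordSpace m → Matrix (Fin m) (Fin m) ℝ
  axis : ∀ u : ℝ, ((u, 0, 0) : CoordSpace m) ∈ coord.target →
    u ∈ I ∧ coord.symm (u, 0, 0) = γ u
  posDef : ∀ x ∈ coord.target, (C x).PosDef
  metric_eq : ∀ x ∈ coord.target, ∀ X : CoordSpace m,
    g.pullback coord.symm x X X = X.1 * X.2.1 + α x * X.2.1 ^ 2
      + ∑ i, β x i * X.2.2 i * X.2.1 + ∑ i, ∑ j, C x i j * X.2.2 i * X.2.2 j

/-- The set of parameters of `γ` covered by the adapted chart. -/
def AdaptedChart.interval {g : LorentzMetric m M} {γ : ℝ → M} {I : Set ℝ}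
    (c : AdaptedChart g γ I) : Set ℝ :=
  {u | ((u, 0, 0) : CoordSpace m) ∈ c.coord.target}

/-- The scaling map `ψ_Ω (u, v, y) = (u, Ω² v, Ω y)`. -/
def penroseScaling {m : ℕ} (Ω : ℝ) (x : CoordSpace m) : CoordSpace m :=
  (x.1, Ω ^ 2 * x.2.1, Ω • x.2.2)

/-- The metric `Ω⁻² ψ_Ω^* g` in an adapted chart, where `ψ_Ω`, being linear, is its own
derivative. -/
def AdaptedChart.scaledMetric {g : LorentzMetric m M} {γ : ℝ → M} {I : Set ℝ}
    (c : AdaptedChart g γ I) (Ω : ℝ) (x X Y : CoordSpace m) : ℝ :=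
  Ω⁻¹ ^ 2 * g.pullback c.coord.symm (penroseScaling Ω x) (penroseScaling Ω X)
    (penroseScaling Ω Y)

/-- A realization, on a manifold `N`, of the Penrose limit of `g` along the null geodesic
`γ : I → M`. One chooses a family of adapted charts that covers `γ`. The chart with index `a`,
which covers the parameters `u ∈ Jₐ` of `γ`, contributes the patch `Jₐ × ℝ^{m+1}` with the metric
`lim_{Ω → 0} Ω⁻² ψ_Ω^* g`; this is the set of those `x` for which `ψ_Ω x` lies in the range of the
chart for all small `Ω > 0`. The patches are glued by the limits
`lim_{Ω → 0} ψ_Ω⁻¹ ∘ (μ_b ∘ μ_a⁻¹) ∘ ψ_Ω` of the rescaled coordinate changes. -/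
structure PenroseLimit (g : LorentzMetric m M) (γ : ℝ → M) (I : Set ℝ) (ι : Type*)
    (N : Type*) [TopologicalSpace N] [ChartedSpace (SpacetimeModel m) N]
    [IsManifold 𝓘(ℝ, SpacetimeModel m) ∞ N] where
  /-- The adapted charts. -/
  chart : ι → AdaptedChart g γ I
  covers : ∀ u ∈ I, ∃ a, u ∈ (chart a).interval
  /-- The metric `g_Pl` of the Penrose limit. -/
  metric : LorentzMetric m N
  /-- The curve `γ`, as a curve in the Penrose limit. -/
  curve : ℝ → N
  /-- The patches, as diffeomorphisms onto open subsets of `N`. -/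
  patch : ι → PartialDiffeomorph 𝓘(ℝ, CoordSpace m) 𝓘(ℝ, SpacetimeModel m) (CoordSpace m) N ∞
  patch_source : ∀ a, (patch a).source = {x | x.1 ∈ (chart a).interval}
  patch_covers : ∀ q : N, ∃ a, q ∈ (patch a).target
  patch_metric : ∀ a, ∀ x ∈ (patch a).source, ∀ X Y : CoordSpace m,
    Tendsto (fun Ω : ℝ ↦ (chart a).scaledMetric Ω x X Y) (𝓝[>] 0)
      (𝓝 (metric.pullback (patch a) x X Y))
  patch_curve : ∀ a, ∀ u ∈ (chart a).interval, patch a (u, 0, 0) = curve u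
  /-- Points of two patches are identified only if they have the same coordinate `u`. -/
  patch_separated : ∀ a b, ∀ x ∈ (patch a).source, ∀ y ∈ (patch b).source,
    patch a x = patch b y → x.1 = y.1
  /-- Over the common parameters `u`, the patches are glued by the limiting coordinate change. -/
  patch_glue : ∀ a b, ∀ x ∈ (patch a).source, x.1 ∈ (chart b).interval →
    ∃ y ∈ (patch b).source, patch a x = patch b y ∧
      Tendsto (fun Ω : ℝ ↦ penroseScaling Ω⁻¹
        ((chart b).coord ((chart a).coord.symm (penroseScaling Ω x)))) (𝓝[>] 0) (𝓝 y)

end Lorentz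

end

/-! The isometries `φ_s` move `γ` along itself, `φ_s (γ u) = γ (σ_s u)`. Read `φ_s` in two adapted
charts and conjugate it by `ψ_Ω`. For `Ω > 0` the result is an isometry between the rescaled metrics
`Ω⁻² ψ_Ω^* g` wherever it is defined, so the task is to let `Ω → 0`.

Conjugation divides the `y`-component by `Ω` and the `v`-component by `Ω²`. Both components vanish
on the axis, which takes care of one factor `Ω`. The second factor in `v` requires that the
differential at the axis send `∂_y` to vectors without `∂_v`-part. This holds because `{dv = 0}` is
the orthogonal complement of `∂_u` (`AdaptedChart.pullback_du`) and `φ_s` maps `∂_u` to a nonzero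
multiple of `∂_u` along the axis (`IsAxisFlow.preservesAxis`). Hadamard's lemma
(`contDiffOn_divFst`) then extends the rescaled family to `Ω = 0`, smoothly in all variables
together (`PreservesAxis.contDiffOn_rescale`).

Identities valid for `Ω > 0` therefore survive in the limit: the group law
(`IsAxisFlow.limitMap_limitMap`) and the isometry property (`IsAxisFlow.limitForm_limitMap`). At `s
= 0` the limit maps are the gluing maps of the Penrose limit, so they fit together to a
one-parameter group of isometries of `N` (`PenroseLimit.flow_patch`), which acts on the limit curve
through the same `σ`. That this curve is a geodesic is seen directly: `g_Pl(∂_u, ·) = dv / 2` has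
constant coefficients (`geodesic_identity`). -/

/-! ### Smoothness of parametric integrals. -/

section ParametricIntegral

universe u

variable {Q E : Type u} [NormedAddCommGroup Q] [NormedSpace ℝ Q] [FiniteDimensional ℝ Q]
  [NormedAddCommGroup E] [NormedSpace ℝ E]

/-- On the compact product of `[0, 1]` with a closed ball around `q` the partial derivative is
continuous, hence bounded. This bound is the dominating function for differentiation under the
integral sign. -/
theorem hasFDerivAt_intervalIntegral_of_contDiffOn {k : ℝ × Q → E} {W : Set (ℝ × Q)}
    {U : Set Q} (hW : IsOpen W) (hU : IsOpen U) (hUW : Icc 0 1 ×ˢ U ⊆ W)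
    (hk : ContDiffOn ℝ 1 k W) {q : Q} (hq : q ∈ U) :
    HasFDerivAt (fun q ↦ ∫ t in (0 : ℝ)..1, k (t, q))
      (∫ t in (0 : ℝ)..1, (fderiv ℝ k (t, q)).comp (ContinuousLinearMap.inr ℝ ℝ Q)) q := by
  have : ProperSpace Q := FiniteDimensional.proper_real Q
  obtain ⟨ε, hε, hεU⟩ := Metric.nhds_basis_closedBall.mem_iff.1 (hU.mem_nhds hq)
  have hk' : ContinuousOn (fun z ↦ (fderiv ℝ k z).comp (ContinuousLinearMap.inr ℝ ℝ Q)) W :=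
    (hk.continuousOn_fderiv_of_isOpen hW le_rfl).clm_comp continuousOn_const
  have hsub : Icc (0 : ℝ) 1 ×ˢ Metric.closedBall q ε ⊆ W :=
    (prod_mono_right hεU).trans hUW
  obtain ⟨C, hC⟩ := (isCompact_Icc.prod (isCompact_closedBall q ε)).exists_bound_of_continuousOn
    (hk'.mono hsub)
  have hmem : ∀ t ∈ Icc (0 : ℝ) 1, ∀ p ∈ U, (t, p) ∈ W := fun t ht p hp ↦ hUW ⟨ht, hp⟩
  have hcont : ∀ p ∈ U, ContinuousOn (fun t : ℝ ↦ k (t, p)) (Icc 0 1) := fun p hp ↦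
    hk.continuousOn.comp (by fun_prop) fun t ht ↦ hmem t ht p hp
  have hcont' : ContinuousOn (fun t : ℝ ↦ (fderiv ℝ k (t, q)).comp
      (ContinuousLinearMap.inr ℝ ℝ Q)) (Icc 0 1) :=
    hk'.comp (f := fun t : ℝ ↦ (t, q)) (by fun_prop) fun t ht ↦ hmem t ht q hq
  have hI : uIoc (0 : ℝ) 1 ⊆ Icc 0 1 := by
    rw [uIoc_of_le zero_le_one]; exact Ioc_subset_Icc_self
  have hbox : ∀ t ∈ uIoc (0 : ℝ) 1, ∀ p ∈ Metric.ball q ε,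
      (t, p) ∈ Icc (0 : ℝ) 1 ×ˢ Metric.closedBall q ε := fun t ht p hp ↦
    ⟨hI ht, Metric.ball_subset_closedBall hp⟩
  have hint : ∀ {G : Type u} [NormedAddCommGroup G] [NormedSpace ℝ G] {h : ℝ → G},
      ContinuousOn h (Icc 0 1) → IntervalIntegrable h MeasureTheory.volume 0 1 := by
    intro G _ _ h hh
    apply ContinuousOn.intervalIntegrable
    rwa [uIcc_of_le zero_le_one]
  refine intervalIntegral.hasFDerivAt_integral_of_dominated_of_fderiv_le (𝕜 := ℝ)
    (bound := fun _ ↦ C) (s := Metric.ball q ε)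
    (F' := fun p t ↦ (fderiv ℝ k (t, p)).comp (ContinuousLinearMap.inr ℝ ℝ Q))
    (Metric.ball_mem_nhds q hε) ?_ (hint (hcont q hq)) ?_ ?_ intervalIntegrable_const ?_
  · filter_upwards [hU.mem_nhds hq] with p hp
    exact (intervalIntegrable_iff.1 (hint (hcont p hp))).aestronglyMeasurable
  · exact (intervalIntegrable_iff.1 (hint hcont')).aestronglyMeasurable
  · exact .of_forall fun t ht p hp ↦ hC (t, p) (hbox t ht p hp)
  · refine .of_forall fun t ht p hp ↦ ?_
    have h1 := ((hk.differentiableOn one_ne_zero _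
      (hsub (hbox t ht p hp))).differentiableAt
      (hW.mem_nhds (hsub (hbox t ht p hp)))).hasFDerivAt
    exact h1.comp p (hasFDerivAt_prodMk_right t p)

/-- The derivative is again a parametric integral, with values in `Q →L[ℝ] E`. The induction
therefore runs over all target spaces at once, and `Q` and `E` share a universe so that this space
is among them. -/
theorem contDiffOn_intervalIntegral_aux (n : ℕ) : ∀ {E : Type u} [NormedAddCommGroup E]
    [NormedSpace ℝ E] {k : ℝ × Q → E} {W : Set (ℝ × Q)} {U : Set Q}, IsOpen W → IsOpen U →
    Icc 0 1 ×ˢ U ⊆ W → ContDiffOn ℝ ∞ k W →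
    ContDiffOn ℝ n (fun q ↦ ∫ t in (0 : ℝ)..1, k (t, q)) U := by
  induction n with
  | zero =>
    intro E _ _ k W U hW hU hUW hk
    rw [Nat.cast_zero, contDiffOn_zero]
    exact fun q hq ↦ (hasFDerivAt_intervalIntegral_of_contDiffOn hW hU hUW
      (hk.of_le (by simp)) hq).continuousAt.continuousWithinAt
  | succ n ih =>
    intro E _ _ k W U hW hU hUW hk
    have hd := fun q (hq : q ∈ U) ↦ hasFDerivAt_intervalIntegral_of_contDiffOn hW hU hUW
      (hk.of_le (by simp)) hq
    rw [Nat.cast_add, Nat.cast_one, contDiffOn_succ_iff_fderiv_of_isOpen hU]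
    refine ⟨fun q hq ↦ (hd q hq).differentiableAt.differentiableWithinAt, by simp, ?_⟩
    refine ContDiffOn.congr (ih (k := fun z ↦ (fderiv ℝ k z).comp
      (ContinuousLinearMap.inr ℝ ℝ Q)) hW hU hUW ?_) fun q hq ↦ (hd q hq).fderiv
    exact (hk.fderiv_of_isOpen hW (by simp)).clm_comp contDiffOn_const

/-- A parametric integral over `[0, 1]` of a smooth function is smooth. -/
theorem contDiffOn_intervalIntegral {k : ℝ × Q → E} {W : Set (ℝ × Q)} {U : Set Q}
    (hW : IsOpen W) (hU : IsOpen U) (hUW : Icc 0 1 ×ˢ U ⊆ W) (hk : ContDiffOn ℝ ∞ k W) :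
    ContDiffOn ℝ ∞ (fun q ↦ ∫ t in (0 : ℝ)..1, k (t, q)) U :=
  contDiffOn_infty.2 fun n ↦ contDiffOn_intervalIntegral_aux n hW hU hUW hk

end ParametricIntegral

/-! ### Hadamard's lemma. -/

section Hadamard

universe u

variable {P E : Type u} [NormedAddCommGroup P] [NormedSpace ℝ P]
  [NormedAddCommGroup E] [NormedSpace ℝ E]

open Classical in
/-- The quotient of `H` by its first variable, with the partial derivative as value where this
variable vanishes. -/
noncomputable def divFst (H : ℝ × P → E) (z : ℝ × P) : E :=
  if z.1 = 0 then fderiv ℝ H z (1, 0) else z.1⁻¹ • H z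

theorem divFst_of_ne {H : ℝ × P → E} {z : ℝ × P} (hz : z.1 ≠ 0) :
    divFst H z = z.1⁻¹ • H z := if_neg hz

theorem divFst_zero (H : ℝ × P → E) (p : P) : divFst H (0, p) = fderiv ℝ H (0, p) (1, 0) :=
  if_pos rfl

/-- Hadamard's lemma: a smooth function that vanishes where its first variable does is smoothly
divisible by this variable. -/
theorem contDiffOn_divFst [FiniteDimensional ℝ P] [CompleteSpace E] {H : ℝ × P → E} {W : Set (ℝ × P)}
    (hW : IsOpen W) (hH : ContDiffOn ℝ ∞ H W) (h0 : ∀ p, (0, p) ∈ W → H (0, p) = 0) :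
    ContDiffOn ℝ ∞ (divFst H) W := by
  rintro ⟨t₀, p₀⟩ hz
  apply ContDiffAt.contDiffWithinAt
  rcases ne_or_eq t₀ 0 with ht | rfl
  · have h1 : ContDiffAt ℝ ∞ (fun z : ℝ × P ↦ z.1⁻¹ • H z) (t₀, p₀) :=
      (contDiffAt_fst.inv ht).smul (hH.contDiffAt (hW.mem_nhds hz))
    refine h1.congr_of_eventuallyEq ?_
    filter_upwards [continuousAt_fst.eventually_ne ht] with z hz' using divFst_of_ne hz'
  -- Near a point with first coordinate `0`, the quotient is `∫₀¹ ∂₁H(t r, p) dt` by the fundamental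
  -- theorem of calculus, which is smooth in `(r, p)`. A ball in the product is stable under
  -- shrinking the first coordinate, so the integrand stays inside `W`.
  obtain ⟨ε, hε, hεW⟩ := Metric.mem_nhds_iff.1 (hW.mem_nhds hz)
  have hmem : ∀ z ∈ Metric.ball ((0 : ℝ), p₀) ε, ∀ t ∈ Icc (0 : ℝ) 1,
      (t * z.1, z.2) ∈ Metric.ball ((0 : ℝ), p₀) ε := by
    rintro ⟨r, p⟩ hz t ht
    rw [← ball_prod_same, mem_prod] at hz ⊢
    refine ⟨?_, hz.2⟩
    have h1 := hz.1
    simp only [Metric.mem_ball, dist_zero_right, norm_mul, Real.norm_eq_abs] at h1 ⊢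
    rw [abs_of_nonneg ht.1]
    exact (mul_le_of_le_one_left (abs_nonneg r) ht.2).trans_lt h1
  have hm : Continuous fun y : ℝ × ℝ × P ↦ (y.1 * y.2.1, y.2.2) := by fun_prop
  have hk : ContDiffOn ℝ ∞ (fun y : ℝ × ℝ × P ↦ fderiv ℝ H (y.1 * y.2.1, y.2.2) (1, 0))
      ((fun y : ℝ × ℝ × P ↦ (y.1 * y.2.1, y.2.2)) ⁻¹' W) := by
    refine ContDiffOn.clm_apply ?_ contDiffOn_const
    exact (hH.fderiv_of_isOpen hW (by simp)).comp (by fun_prop) fun y hy ↦ hy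
  have h2 := contDiffOn_intervalIntegral (hW.preimage hm) Metric.isOpen_ball
    (fun y hy ↦ hεW (hmem y.2 hy.2 y.1 hy.1)) hk
  refine (h2.contDiffAt (Metric.ball_mem_nhds _ hε)).congr_of_eventuallyEq ?_
  filter_upwards [Metric.ball_mem_nhds _ hε] with z hz
  obtain ⟨r, p⟩ := z
  rcases eq_or_ne r 0 with rfl | hr
  · simp [divFst_zero]
  rw [divFst_of_ne hr]
  have hd : ∀ t ∈ uIcc (0 : ℝ) 1, HasDerivAt (fun t ↦ H (t * r, p))
      (r • fderiv ℝ H (t * r, p) (1, 0)) t := by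
    intro t ht
    rw [uIcc_of_le zero_le_one] at ht
    have hW' := hεW (hmem _ hz t ht)
    have h3 := ((hH.contDiffAt (hW.mem_nhds hW')).differentiableAt (by simp)).hasFDerivAt
    have h4 : HasDerivAt (fun t : ℝ ↦ (t * r, p)) (r, 0) t := by
      simpa using ((hasDerivAt_id t).mul_const r).prodMk (hasDerivAt_const t p)
    have h5 := h3.comp_hasDerivAt t h4
    rw [← map_smul]
    simpa [Function.comp_def] using h5
  have hc : ContinuousOn (fun t ↦ fderiv ℝ H (t * r, p) (1, 0)) (uIcc 0 1) := by
    rw [uIcc_of_le zero_le_one]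
    exact hk.continuousOn.comp (f := fun t : ℝ ↦ (t, r, p)) (by fun_prop)
      fun t ht ↦ hεW (hmem _ hz t ht)
  have h6 := intervalIntegral.integral_eq_sub_of_hasDerivAt hd
    (hc.const_smul r).intervalIntegrable
  have h7 : H (0, p) = 0 := h0 p (by simpa using hεW (hmem _ hz 0 (by simp)))
  rw [intervalIntegral.integral_smul] at h6
  simp only [one_mul, zero_mul, h7, sub_zero] at h6
  simp only [← h6, smul_smul, inv_mul_cancel₀ hr, one_smul]

end Hadamard

/-! ### Rescaled families of maps and their extension to `Ω = 0`. -/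

section Rescaling

variable {m : ℕ}

theorem penroseScaling_zero_left (x : CoordSpace m) : penroseScaling 0 x = (x.1, 0, 0) := by
  simp [penroseScaling]

theorem penroseScaling_axis (Ω u : ℝ) :
    penroseScaling Ω ((u, 0, 0) : CoordSpace m) = (u, 0, 0) := by
  simp [penroseScaling]

theorem penroseScaling_inv_cancel {Ω : ℝ} (hΩ : Ω ≠ 0) (x : CoordSpace m) :
    penroseScaling Ω⁻¹ (penroseScaling Ω x) = x := by
  simp [penroseScaling, smul_smul, hΩ]

theorem penroseScaling_cancel_inv {Ω : ℝ} (hΩ : Ω ≠ 0) (x : CoordSpace m) :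
    penroseScaling Ω (penroseScaling Ω⁻¹ x) = x := by
  simpa using penroseScaling_inv_cancel (inv_ne_zero hΩ) x

theorem contDiff_penroseScaling :
    ContDiff ℝ ∞ fun z : ℝ × CoordSpace m ↦ penroseScaling z.1 z.2 := by
  unfold penroseScaling; fun_prop

theorem continuous_penroseScaling :
    Continuous fun z : ℝ × CoordSpace m ↦ penroseScaling z.1 z.2 :=
  contDiff_penroseScaling.continuous

/-- The scaling map as a continuous linear map. -/
noncomputable def penroseScalingL (m : ℕ) (Ω : ℝ) : CoordSpace m →L[ℝ] CoordSpace m :=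
  (ContinuousLinearMap.id ℝ ℝ).prodMap
    ((Ω ^ 2 • ContinuousLinearMap.id ℝ ℝ).prodMap (Ω • ContinuousLinearMap.id ℝ _))

@[simp]
theorem penroseScalingL_apply (Ω : ℝ) (x : CoordSpace m) :
    penroseScalingL m Ω x = penroseScaling Ω x := rfl

/-- The domain of the rescaled family of maps. -/
def rescaleDomain (D : Set (ℝ × CoordSpace m)) : Set (ℝ × ℝ × CoordSpace m) :=
  {z | (z.2.1, penroseScaling z.1 z.2.2) ∈ D}

/-- The family `ψ_Ω⁻¹ ∘ f_s ∘ ψ_Ω`, extended to `Ω = 0`. -/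
noncomputable def rescale (f : ℝ × CoordSpace m → CoordSpace m) (z : ℝ × ℝ × CoordSpace m) :
    CoordSpace m :=
  ((f (z.2.1, penroseScaling z.1 z.2.2)).1,
    divFst (divFst fun w ↦ (f (w.2.1, penroseScaling w.1 w.2.2)).2.1) z,
    divFst (fun w ↦ (f (w.2.1, penroseScaling w.1 w.2.2)).2.2) z)

theorem isOpen_rescaleDomain {D : Set (ℝ × CoordSpace m)} (hD : IsOpen D) :
    IsOpen (rescaleDomain D) := by
  refine hD.preimage ?_
  exact (continuous_fst.comp continuous_snd).prodMk
    (continuous_penroseScaling.comp (continuous_fst.prodMk (continuous_snd.comp continuous_snd)))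

theorem rescale_of_ne (f : ℝ × CoordSpace m → CoordSpace m) {Ω : ℝ} (hΩ : Ω ≠ 0) (s : ℝ)
    (x : CoordSpace m) :
    rescale f (Ω, s, x) = penroseScaling Ω⁻¹ (f (s, penroseScaling Ω x)) := by
  simp [rescale, divFst_of_ne, hΩ, penroseScaling, pow_two, mul_assoc]

theorem rescale_zero_fst (f : ℝ × CoordSpace m → CoordSpace m) (s : ℝ) (x : CoordSpace m) :
    (rescale f (0, s, x)).1 = (f (s, (x.1, 0, 0))).1 := by
  simp [rescale, penroseScaling_zero_left]

/-- The conditions on a family of maps under which it can be rescaled: it preserves the axis, and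
at the axis its differential preserves the hyperplane spanned by `∂_u` and `∂_y`. -/
structure PreservesAxis (f : ℝ × CoordSpace m → CoordSpace m) (D : Set (ℝ × CoordSpace m)) :
    Prop where
  isOpen : IsOpen D
  contDiffOn : ContDiffOn ℝ ∞ f D
  axis : ∀ s u : ℝ, (s, ((u, 0, 0) : CoordSpace m)) ∈ D → (f (s, (u, 0, 0))).2 = 0
  fderiv_axis : ∀ s u : ℝ, ∀ y, (s, ((u, 0, 0) : CoordSpace m)) ∈ D →
    (fderiv ℝ f (s, (u, 0, 0)) (0, 0, 0, y)).2.1 = 0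

variable {f : ℝ × CoordSpace m → CoordSpace m} {D : Set (ℝ × CoordSpace m)}

theorem PreservesAxis.contDiffOn_scaled (hf : PreservesAxis f D) :
    ContDiffOn ℝ ∞ (fun w : ℝ × ℝ × CoordSpace m ↦ f (w.2.1, penroseScaling w.1 w.2.2))
      (rescaleDomain D) := by
  refine hf.contDiffOn.comp (ContDiff.contDiffOn ?_) fun z hz ↦ hz
  exact (contDiff_fst.comp contDiff_snd).prodMk
    (contDiff_penroseScaling.comp (contDiff_fst.prodMk (contDiff_snd.comp contDiff_snd)))

theorem PreservesAxis.contDiffOn_rescale (hf : PreservesAxis f D) :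
    ContDiffOn ℝ ∞ (rescale f) (rescaleDomain D) := by
  have hW := isOpen_rescaleDomain hf.isOpen
  have h := hf.contDiffOn_scaled
  have hax : ∀ p : ℝ × CoordSpace m, ((0 : ℝ), p) ∈ rescaleDomain D →
      (p.1, ((p.2.1, 0, 0) : CoordSpace m)) ∈ D := by
    intro p hp
    simpa [rescaleDomain, penroseScaling_zero_left] using hp
  refine h.fst.prodMk (ContDiffOn.prodMk ?_ ?_)
  -- Two divisions by `Ω` need two vanishing conditions at `Ω = 0`: the `v`-component itself, and
  -- its first `Ω`-derivative.
  · refine contDiffOn_divFst hW (contDiffOn_divFst hW h.snd.fst fun p hp ↦ ?_) fun p hp ↦ ?_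
    · simp [penroseScaling_zero_left, hf.axis _ _ (hax p hp)]
    · rw [divFst_zero]
      have hd : HasFDerivAt f (fderiv ℝ f (p.1, (p.2.1, 0, 0))) (p.1, penroseScaling 0 p.2) := by
        rw [penroseScaling_zero_left]
        exact ((hf.contDiffOn.contDiffAt (hf.isOpen.mem_nhds (hax p hp))).differentiableAt
          (by simp)).hasFDerivAt
      -- The term `Ω² v` has zero derivative at `Ω = 0`, so only the direction `∂_y` remains, and
      -- `fderiv_axis` applies to it.
      have hψ : HasDerivAt (fun t : ℝ ↦ (p.1, penroseScaling t p.2))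
          (0, 0, 0, p.2.2.2) 0 := by
        have h1 : HasDerivAt (fun t : ℝ ↦ t ^ 2 * p.2.2.1) 0 0 := by
          simpa using ((hasDerivAt_id (0 : ℝ)).pow 2).mul_const p.2.2.1
        have h2 : HasDerivAt (fun t : ℝ ↦ t • p.2.2.2) p.2.2.2 0 := by
          simpa using (hasDerivAt_id (0 : ℝ)).smul_const p.2.2.2
        simpa [penroseScaling] using (hasDerivAt_const (0 : ℝ) p.1).prodMk
          ((hasDerivAt_const (0 : ℝ) p.2.1).prodMk (h1.prodMk h2))
      have hc := hd.comp_hasDerivAt (0 : ℝ) hψ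
      have hG := ((h.snd.fst.contDiffAt (hW.mem_nhds hp)).differentiableAt
        (by simp)).hasFDerivAt.comp_hasDerivAt (0 : ℝ)
        ((hasDerivAt_id (0 : ℝ)).prodMk (hasDerivAt_const (0 : ℝ) p))
      exact (hG.unique (((ContinuousLinearMap.fst ℝ ℝ _).comp (ContinuousLinearMap.snd ℝ ℝ
        (ℝ × EuclideanSpace ℝ (Fin m)))).hasFDerivAt.comp_hasDerivAt (0 : ℝ) hc)).trans
        (hf.fderiv_axis _ _ _ (hax p hp))
  · refine contDiffOn_divFst hW h.snd.snd fun p hp ↦ ?_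
    simp [penroseScaling_zero_left, hf.axis _ _ (hax p hp)]

/-- The scaling fixes the axis pointwise, so for `Ω ≠ 0` conjugation changes nothing there; `Ω = 0`
follows by continuity. -/
theorem rescale_axis (hf : PreservesAxis f D) {Ω s u : ℝ}
    (h : (s, ((u, 0, 0) : CoordSpace m)) ∈ D) :
    rescale f (Ω, s, (u, 0, 0)) = f (s, (u, 0, 0)) := by
  have hne : ∀ Ω : ℝ, Ω ≠ 0 → rescale f (Ω, s, (u, 0, 0)) = f (s, (u, 0, 0)) := by
    intro Ω hΩ
    rw [rescale_of_ne f hΩ, penroseScaling_axis]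
    have := hf.axis s u h
    rw [show f (s, (u, 0, 0)) = ((f (s, (u, 0, 0))).1, 0, 0) from Prod.ext rfl this,
      penroseScaling_axis]
  rcases ne_or_eq Ω 0 with hΩ | rfl
  · exact hne Ω hΩ
  have hc : ContinuousAt (fun Ω : ℝ ↦ rescale f (Ω, s, (u, 0, 0))) 0 := by
    refine ContinuousAt.comp (f := fun Ω : ℝ ↦ (Ω, s, ((u, 0, 0) : CoordSpace m)))
      (hf.contDiffOn_rescale.continuousOn.continuousAt
      ((isOpen_rescaleDomain hf.isOpen).mem_nhds ?_)) (by fun_prop)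
    simpa [rescaleDomain, penroseScaling_axis] using h
  refine tendsto_nhds_unique (hc.tendsto.mono_left nhdsWithin_le_nhds : Tendsto _ (𝓝[≠] (0 : ℝ)) _)
    (tendsto_const_nhds.congr' ?_)
  filter_upwards [self_mem_nhdsWithin] with Ω hΩ using (hne Ω hΩ).symm

end Rescaling

/-! ### Pullbacks of Lorentzian metrics. -/

section Pullback

variable {m : ℕ} {M : Type*} [TopologicalSpace M] [ChartedSpace (SpacetimeModel m) M]
  [IsManifold 𝓘(ℝ, SpacetimeModel m) ∞ M]
  {F F' : Type*} [NormedAddCommGroup F] [NormedSpace ℝ F]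
  [NormedAddCommGroup F'] [NormedSpace ℝ F']

/-- The pullback of a metric as a continuous bilinear form. -/
noncomputable def LorentzMetric.pullbackL (g : LorentzMetric m M) (f : F → M) (x : F) :
    F →L[ℝ] F →L[ℝ] ℝ :=
  let D : F →L[ℝ] SpacetimeModel m := mfderiv 𝓘(ℝ, F) 𝓘(ℝ, SpacetimeModel m) f x
  let G : SpacetimeModel m →L[ℝ] SpacetimeModel m →L[ℝ] ℝ := g.val (f x)
  G.bilinearComp D D

theorem LorentzMetric.pullbackL_apply (g : LorentzMetric m M) (f : F → M) (x X Y : F) :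
    g.pullbackL f x X Y = g.pullback f x X Y := rfl

theorem LorentzMetric.pullback_symm (g : LorentzMetric m M) (f : F → M) (x X Y : F) :
    g.pullback f x X Y = g.pullback f x Y X := g.symm _ _ _

theorem LorentzMetric.pullbackL_symm (g : LorentzMetric m M) (f : F → M) (x X Y : F) :
    g.pullbackL f x X Y = g.pullbackL f x Y X := g.pullback_symm f x X Y

theorem LorentzMetric.pullback_congr (g : LorentzMetric m M) {f f' : F → M} {x : F}
    (h : f =ᶠ[𝓝 x] f') (X Y : F) : g.pullback f x X Y = g.pullback f' x X Y := by
  have h1 := h.mfderiv_eq (I := 𝓘(ℝ, F)) (I' := 𝓘(ℝ, SpacetimeModel m))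
  have h2 := h.self_of_nhds
  -- The two base points are equal only propositionally, so the comparison is made for linear maps
  -- into the model space, whose type does not depend on the point.
  have key : ∀ p q : M, p = q → ∀ A : F → SpacetimeModel m,
      g.val p (A X) (A Y) = g.val q (A X) (A Y) := by
    rintro p _ rfl A
    rfl
  unfold LorentzMetric.pullback
  rw [h1]
  exact key _ _ h2 _

theorem LorentzMetric.pullback_comp (g : LorentzMetric m M) {f : F → M} {h : F' → F} {x : F'}
    (hf : MDifferentiableAt 𝓘(ℝ, F) 𝓘(ℝ, SpacetimeModel m) f (h x))
    (hh : DifferentiableAt ℝ h x) (X Y : F') :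
    g.pullback (f ∘ h) x X Y = g.pullback f (h x) (fderiv ℝ h x X) (fderiv ℝ h x Y) := by
  unfold LorentzMetric.pullback
  rw [mfderiv_comp x hf hh.mdifferentiableAt, mfderiv_eq_fderiv]
  rfl

theorem LorentzMetric.pullback_isometry (g : LorentzMetric m M) {φ : ℝ → M → M}
    (hφ : IsOneParameterIsometryGroup g φ) (s : ℝ) {f : F → M} {x : F}
    (hf : MDifferentiableAt 𝓘(ℝ, F) 𝓘(ℝ, SpacetimeModel m) f x) (X Y : F) :
    g.pullback (φ s ∘ f) x X Y = g.pullback f x X Y := by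
  have hs : ContMDiff 𝓘(ℝ, SpacetimeModel m) 𝓘(ℝ, SpacetimeModel m) ∞ (φ s) :=
    hφ.smooth.comp (contMDiff_const.prodMk contMDiff_id)
  unfold LorentzMetric.pullback
  rw [mfderiv_comp x (hs.mdifferentiableAt (by simp)) hf]
  exact hφ.isometry s (f x) _ _

/-- The tangent map of `f` sends constant vector fields to smooth fields along `f`, and the metric
is a smooth section of the bundle of bilinear forms; evaluating one on the others is smooth. -/
theorem LorentzMetric.contDiffOn_pullback (g : LorentzMetric m M) {f : F → M} {U : Set F}
    (hU : IsOpen U) (hf : ContMDiffOn 𝓘(ℝ, F) 𝓘(ℝ, SpacetimeModel m) ∞ f U) (X Y : F) :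
    ContDiffOn ℝ ∞ (fun x ↦ g.pullback f x X Y) U := by
  have hv : ∀ X : F, ContMDiffOn 𝓘(ℝ, F) 𝓘(ℝ, SpacetimeModel m).tangent ∞
      (fun x ↦ Bundle.TotalSpace.mk' (SpacetimeModel m)
        (E := fun x : M ↦ TangentSpace 𝓘(ℝ, SpacetimeModel m) x) (f x)
        (mfderiv 𝓘(ℝ, F) 𝓘(ℝ, SpacetimeModel m) f x X)) U := by
    intro X
    have h1 := hf.contMDiffOn_tangentMapWithin (m := ∞) (by simp) hU.uniqueMDiffOn
    have h2 : ContMDiff 𝓘(ℝ, F) 𝓘(ℝ, F).tangent ∞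
        (fun x : F ↦ Bundle.TotalSpace.mk' F (E := fun x : F ↦ TangentSpace 𝓘(ℝ, F) x) x X) := by
      intro x
      exact contMDiffAt_vectorSpace_iff_contDiffAt.2 contDiffAt_const
    refine (h1.comp h2.contMDiffOn fun x hx ↦ hx).congr fun x hx ↦ ?_
    simp [tangentMapWithin, mfderivWithin_of_isOpen hU hx]
  have hg := g.contMDiff.comp_contMDiffOn hf
  have := ContMDiffOn.clm_bundle_apply₂ (F₁ := SpacetimeModel m) (F₂ := SpacetimeModel m)
    (F₃ := ℝ) (E₃ := fun _ ↦ ℝ) hg (hv X) (hv Y)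
  rw [← contMDiffOn_iff_contDiffOn]
  intro x hx
  exact (Bundle.contMDiffWithinAt_totalSpace.1 (this x hx)).2

theorem LorentzMetric.contDiffOn_pullbackL [FiniteDimensional ℝ F] (g : LorentzMetric m M)
    {f : F → M} {U : Set F}
    (hU : IsOpen U) (hf : ContMDiffOn 𝓘(ℝ, F) 𝓘(ℝ, SpacetimeModel m) ∞ f U) :
    ContDiffOn ℝ ∞ (g.pullbackL f) U :=
  contDiffOn_clm_apply.2 fun X ↦ contDiffOn_clm_apply.2 fun Y ↦ g.contDiffOn_pullback hU hf X Y

end Pullback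

theorem tendsto_clm_apply {α E F : Type*} [NormedAddCommGroup E] [NormedSpace ℝ E]
    [NormedAddCommGroup F] [NormedSpace ℝ F] {l : Filter α} {f : α → E →L[ℝ] F} {x : α → E}
    {f₀ : E →L[ℝ] F} {x₀ : E} (hf : Tendsto f l (𝓝 f₀)) (hx : Tendsto x l (𝓝 x₀)) :
    Tendsto (fun a ↦ f a (x a)) l (𝓝 (f₀ x₀)) :=
  (isBoundedBilinearMap_apply.continuous.tendsto (f₀, x₀)).comp (hf.prodMk_nhds hx)

/-! ### Adapted charts and the limit of the rescaled metrics. -/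

namespace AdaptedChart

variable {m : ℕ} {M : Type*} [TopologicalSpace M] [ChartedSpace (SpacetimeModel m) M]
  [IsManifold 𝓘(ℝ, SpacetimeModel m) ∞ M] {g : LorentzMetric m M} {γ : ℝ → M} {I : Set ℝ}
  (c : AdaptedChart g γ I)

theorem isOpen_interval : IsOpen c.interval :=
  c.coord.open_target.preimage (f := fun u : ℝ ↦ ((u, 0, 0) : CoordSpace m)) (by fun_prop)

theorem interval_subset : c.interval ⊆ I := fun u hu ↦ (c.axis u hu).1

theorem symm_axis {u : ℝ} (hu : u ∈ c.interval) : c.coord.symm (u, 0, 0) = γ u :=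
  (c.axis u hu).2

theorem contMDiffOn_symm :
    ContMDiffOn 𝓘(ℝ, CoordSpace m) 𝓘(ℝ, SpacetimeModel m) ∞ c.coord.symm c.coord.target :=
  c.coord.contMDiffOn_invFun

theorem mdifferentiableAt_symm {x : CoordSpace m} (hx : x ∈ c.coord.target) :
    MDifferentiableAt 𝓘(ℝ, CoordSpace m) 𝓘(ℝ, SpacetimeModel m) c.coord.symm x :=
  (c.contMDiffOn_symm.contMDiffAt (c.coord.open_target.mem_nhds hx)).mdifferentiableAt (by simp)

theorem coord_symm {x : CoordSpace m} (hx : x ∈ c.coord.target) :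
    c.coord (c.coord.symm x) = x := c.coord.right_inv hx

theorem symm_coord {p : M} (hp : p ∈ c.coord.source) :
    c.coord.symm (c.coord p) = p := c.coord.left_inv hp

theorem symm_mem {x : CoordSpace m} (hx : x ∈ c.coord.target) :
    c.coord.symm x ∈ c.coord.source := c.coord.map_target hx

theorem coord_mem {p : M} (hp : p ∈ c.coord.source) : c.coord p ∈ c.coord.target :=
  c.coord.map_source hp

theorem mem_source {u : ℝ} (hu : u ∈ c.interval) : γ u ∈ c.coord.source := by
  rw [← c.symm_axis hu]
  exact c.symm_mem hu

theorem coord_axis {u : ℝ} (hu : u ∈ c.interval) : c.coord (γ u) = (u, 0, 0) := by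
  rw [← c.symm_axis hu]
  exact c.coord_symm hu

/-- Polarization of the quadratic form at `∂_u + Y`. The special form of the metric enters the rest
of the argument only through this identity. -/
theorem pullback_du {x : CoordSpace m} (hx : x ∈ c.coord.target) (Y : CoordSpace m) :
    g.pullback c.coord.symm x (1, 0, 0) Y = Y.2.1 / 2 := by
  have h1 := c.metric_eq x hx ((1, 0, 0) + Y)
  have h2 := c.metric_eq x hx (1, 0, 0)
  have h3 := c.metric_eq x hx Y
  rw [← LorentzMetric.pullbackL_apply] at h1
  simp only [map_add, add_apply, LorentzMetric.pullbackL_apply] at h1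
  rw [g.pullback_symm _ x Y (1, 0, 0), h2, h3] at h1
  simp only [Prod.fst_add, Prod.snd_add, zero_add, mul_zero, add_zero, ne_eq, OfNat.ofNat_ne_zero,
    not_false_eq_true, zero_pow, PiLp.zero_apply, Finset.sum_const_zero] at h1
  linarith

theorem continuousOn_pullbackL : ContinuousOn (g.pullbackL c.coord.symm) c.coord.target :=
  (g.contDiffOn_pullbackL c.coord.open_target c.contMDiffOn_symm).continuousOn

/-- The limit of the rescaled metrics, as a function of `u` and two tangent vectors. -/
noncomputable def limitForm (u : ℝ) (X Y : CoordSpace m) : ℝ :=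
  (X.1 * Y.2.1 + X.2.1 * Y.1) / 2
    + g.pullbackL c.coord.symm (u, 0, 0) (0, 0, X.2.2) (0, 0, Y.2.2)

/-- The vector `ψ_Ω Z` splits as `Z_u ∂_u + Ω (0, Ω Z_v, Z_y)`. Products with `∂_u` are known from
`pullback_du` and carry `Ω²`, as do products of the remainders. The factor `Ω⁻²` cancels, and what
is left is continuous at `Ω = 0`. -/
theorem scaledMetric_eq {Ω : ℝ} (hΩ : Ω ≠ 0) {x : CoordSpace m}
    (hx : penroseScaling Ω x ∈ c.coord.target) (X Y : CoordSpace m) :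
    c.scaledMetric Ω x X Y = (X.1 * Y.2.1 + X.2.1 * Y.1) / 2
      + g.pullbackL c.coord.symm (penroseScaling Ω x) (0, Ω * X.2.1, X.2.2)
        (0, Ω * Y.2.1, Y.2.2) := by
  have hdec : ∀ Z : CoordSpace m, penroseScaling Ω Z =
      Z.1 • ((1, 0, 0) : CoordSpace m) + Ω • ((0, Ω * Z.2.1, Z.2.2) : CoordSpace m) := by
    intro Z
    simp [penroseScaling, pow_two, mul_assoc]
  have hdu := c.pullback_du hx
  have hdu' : ∀ Z : CoordSpace m,
      g.pullback c.coord.symm (penroseScaling Ω x) Z (1, 0, 0) = Z.2.1 / 2 :=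
    fun Z ↦ by rw [g.pullback_symm, hdu]
  unfold scaledMetric
  rw [hdec X, hdec Y, ← LorentzMetric.pullbackL_apply]
  simp only [map_add, add_apply, map_smul, smul_apply]
  simp only [LorentzMetric.pullbackL_apply, hdu, hdu', smul_eq_mul]
  field_simp
  ring

/-- The point and the vectors may vary with `Ω`, because this is applied to images under the
rescaled isometries and their differentials. -/
theorem tendsto_scaledMetric {x : ℝ → CoordSpace m} {X Y : ℝ → CoordSpace m}
    {x₀ X₀ Y₀ : CoordSpace m} (hx₀ : x₀.1 ∈ c.interval)
    (hx : Tendsto x (𝓝[>] 0) (𝓝 x₀)) (hX : Tendsto X (𝓝[>] 0) (𝓝 X₀))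
    (hY : Tendsto Y (𝓝[>] 0) (𝓝 Y₀)) :
    Tendsto (fun Ω : ℝ ↦ c.scaledMetric Ω (x Ω) (X Ω) (Y Ω)) (𝓝[>] 0)
      (𝓝 (c.limitForm x₀.1 X₀ Y₀)) := by
  have hid : Tendsto (fun Ω : ℝ ↦ Ω) (𝓝[>] 0) (𝓝 0) := nhdsWithin_le_nhds
  have hψ : Tendsto (fun Ω : ℝ ↦ penroseScaling Ω (x Ω)) (𝓝[>] 0) (𝓝 (x₀.1, 0, 0)) := by
    rw [← penroseScaling_zero_left]
    exact (continuous_penroseScaling.tendsto (0, x₀)).comp (hid.prodMk_nhds hx)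
  have hP := (c.continuousOn_pullbackL.continuousAt (c.coord.open_target.mem_nhds hx₀)).tendsto.comp
    hψ
  have hv : ∀ {Z : ℝ → CoordSpace m} {Z₀ : CoordSpace m}, Tendsto Z (𝓝[>] 0) (𝓝 Z₀) →
      Tendsto (fun Ω : ℝ ↦ ((0, Ω * (Z Ω).2.1, (Z Ω).2.2) : CoordSpace m)) (𝓝[>] 0)
        (𝓝 (0, 0, Z₀.2.2)) := by
    intro Z Z₀ hZ
    refine tendsto_const_nhds.prodMk_nhds (Tendsto.prodMk_nhds ?_ hZ.snd_nhds.snd_nhds)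
    simpa using hid.mul hZ.snd_nhds.fst_nhds
  have h1 := ((hX.fst_nhds.mul hY.snd_nhds.fst_nhds).add
    (hX.snd_nhds.fst_nhds.mul hY.fst_nhds)).div_const 2
  refine (h1.add (tendsto_clm_apply (tendsto_clm_apply hP (hv hX)) (hv hY))).congr' ?_
  filter_upwards [self_mem_nhdsWithin, hψ.eventually (c.coord.open_target.mem_nhds hx₀)]
    with Ω hΩ hmem
  exact (c.scaledMetric_eq (ne_of_gt hΩ) hmem _ _).symm

end AdaptedChart

/-! ### Isometries moving `γ` along itself, in adapted charts. -/

section Transition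

variable {m : ℕ} {M : Type*} [TopologicalSpace M] [ChartedSpace (SpacetimeModel m) M]
  [IsManifold 𝓘(ℝ, SpacetimeModel m) ∞ M] {g : LorentzMetric m M} {γ : ℝ → M} {I : Set ℝ}
  {φ : ℝ → M → M} {σ : ℝ → ℝ → ℝ}

/-- `σ` is a flow on the parameters in `I` such that the one-parameter group of isometries `φ`
acts on the curve `γ` through `σ`. -/
structure IsAxisFlow (g : LorentzMetric m M) (γ : ℝ → M) (I : Set ℝ) (φ : ℝ → M → M)
    (σ : ℝ → ℝ → ℝ) : Prop where
  isometryGroup : IsOneParameterIsometryGroup g φ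
  isOpen : IsOpen I
  mapsTo : ∀ s, ∀ u ∈ I, σ s u ∈ I
  zero : ∀ u ∈ I, σ 0 u = u
  add : ∀ s t, ∀ u ∈ I, σ (s + t) u = σ s (σ t u)
  continuousOn : ContinuousOn (fun z : ℝ × ℝ ↦ σ z.1 z.2) (univ ×ˢ I)
  curve : ∀ s, ∀ u ∈ I, φ s (γ u) = γ (σ s u)

/-- The map `φ_s` in two adapted charts. -/
noncomputable def flowInCharts (φ : ℝ → M → M) (c d : AdaptedChart g γ I) (z : ℝ × CoordSpace m) :
    CoordSpace m :=
  d.coord (φ z.1 (c.coord.symm z.2))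

/-- A set on which the map `φ_s` is defined in two adapted charts and preserves the axis. -/
def flowDomain (φ : ℝ → M → M) (σ : ℝ → ℝ → ℝ) (c d : AdaptedChart g γ I) :
    Set (ℝ × CoordSpace m) :=
  {z | z.2 ∈ c.coord.target ∧ z.2.1 ∈ c.interval ∧ σ z.1 z.2.1 ∈ d.interval ∧
    φ z.1 (c.coord.symm z.2) ∈ d.coord.source}

variable (h : IsAxisFlow g γ I φ σ) (c d : AdaptedChart g γ I)

include h

theorem IsAxisFlow.isOpen_pairs (J K : Set ℝ) (hJ : IsOpen J) (hJI : J ⊆ I) (hK : IsOpen K) :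
    IsOpen {z : ℝ × ℝ | z.2 ∈ J ∧ σ z.1 z.2 ∈ K} := by
  have h1 := (h.continuousOn.mono (prod_mono_right hJI)).isOpen_inter_preimage
    (isOpen_univ.prod hJ) hK
  convert h1 using 1
  ext z
  simp

theorem IsAxisFlow.contMDiffOn_lift : ContMDiffOn 𝓘(ℝ, ℝ × CoordSpace m) 𝓘(ℝ, SpacetimeModel m) ∞
    (fun z : ℝ × CoordSpace m ↦ φ z.1 (c.coord.symm z.2)) (Prod.snd ⁻¹' c.coord.target) := by
  refine h.isometryGroup.smooth.comp_contMDiffOn (ContMDiffOn.prodMk ?_ ?_)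
  · exact contDiff_fst.contMDiff.contMDiffOn
  · exact c.contMDiffOn_symm.comp contDiff_snd.contMDiff.contMDiffOn fun z hz ↦ hz

theorem IsAxisFlow.isOpen_flowDomain : IsOpen (flowDomain φ σ c d) := by
  have h1 := (h.contMDiffOn_lift c).continuousOn.isOpen_inter_preimage
    (c.coord.open_target.preimage continuous_snd) d.coord.open_source
  have h2 := (h.isOpen_pairs c.interval d.interval c.isOpen_interval c.interval_subset
    d.isOpen_interval).preimage (f := fun z : ℝ × CoordSpace m ↦ (z.1, z.2.1)) (by fun_prop)
  convert h1.inter h2 using 1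
  ext z
  simp only [flowDomain, mem_ofPred_eq, mem_inter_iff, mem_preimage]
  tauto

theorem IsAxisFlow.axis_mem_flowDomain {s u : ℝ} (hu : u ∈ c.interval)
    (hs : σ s u ∈ d.interval) : (s, ((u, 0, 0) : CoordSpace m)) ∈ flowDomain φ σ c d := by
  refine ⟨hu, hu, hs, ?_⟩
  rw [c.symm_axis hu, h.curve s u (c.interval_subset hu)]
  exact d.mem_source hs

theorem IsAxisFlow.flowInCharts_axis {s u : ℝ} (hu : u ∈ c.interval)
    (hs : σ s u ∈ d.interval) : flowInCharts φ c d (s, (u, 0, 0)) = (σ s u, 0, 0) := by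
  rw [flowInCharts, c.symm_axis hu, h.curve s u (c.interval_subset hu), d.coord_axis hs]

theorem IsAxisFlow.contDiffOn_flowInCharts :
    ContDiffOn ℝ ∞ (flowInCharts φ c d) (flowDomain φ σ c d) := by
  rw [← contMDiffOn_iff_contDiffOn]
  exact d.coord.contMDiffOn_toFun.comp ((h.contMDiffOn_lift c).mono fun z hz ↦ hz.1)
    fun z hz ↦ hz.2.2.2

theorem IsAxisFlow.differentiableAt_flowInCharts {s : ℝ} {x : CoordSpace m}
    (hx : (s, x) ∈ flowDomain φ σ c d) :
    DifferentiableAt ℝ (fun y ↦ flowInCharts φ c d (s, y)) x :=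
  (((h.contDiffOn_flowInCharts c d).contDiffAt
    ((h.isOpen_flowDomain c d).mem_nhds hx)).differentiableAt (by simp)).comp x
    ((differentiableAt_const s).prodMk differentiableAt_id)

theorem IsAxisFlow.pullback_flowInCharts {s : ℝ} {x : CoordSpace m}
    (hx : (s, x) ∈ flowDomain φ σ c d) (X Y : CoordSpace m) :
    g.pullback d.coord.symm (flowInCharts φ c d (s, x))
      (fderiv ℝ (fun y ↦ flowInCharts φ c d (s, y)) x X)
      (fderiv ℝ (fun y ↦ flowInCharts φ c d (s, y)) x Y) = g.pullback c.coord.symm x X Y := by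
  rw [← g.pullback_comp (h := fun y ↦ flowInCharts φ c d (s, y))
    (d.mdifferentiableAt_symm (d.coord_mem hx.2.2.2)) (h.differentiableAt_flowInCharts c d hx),
    ← g.pullback_isometry h.isometryGroup s (c.mdifferentiableAt_symm hx.1)]
  refine g.pullback_congr ?_ X Y
  have hev : ∀ᶠ y in 𝓝 x, (s, y) ∈ flowDomain φ σ c d :=
    ((h.isOpen_flowDomain c d).preimage (by fun_prop : Continuous fun y ↦ (s, y))).mem_nhds hx
  filter_upwards [hev] with y hy using d.symm_coord hy.2.2.2

/-- An isometry respects orthogonal complements. Along the axis it maps `∂_u` to a multiple of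
`∂_u`, hence `∂_u^⊥ = {dv = 0}` into itself, and `∂_y` lies in this hyperplane. -/
theorem IsAxisFlow.preservesAxis :
    PreservesAxis (flowInCharts φ c d) (flowDomain φ σ c d) where
  isOpen := h.isOpen_flowDomain c d
  contDiffOn := h.contDiffOn_flowInCharts c d
  axis s u hz := by rw [h.flowInCharts_axis c d hz.2.1 hz.2.2.1]; rfl
  fderiv_axis s u y hz := by
    set A := fderiv ℝ (fun y ↦ flowInCharts φ c d (s, y)) (u, 0, 0) with hA
    have hA' : ∀ X, fderiv ℝ (flowInCharts φ c d) (s, (u, 0, 0)) (0, X) = A X := by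
      intro X
      have h1 := ((h.contDiffOn_flowInCharts c d).contDiffAt
        ((h.isOpen_flowDomain c d).mem_nhds hz)).differentiableAt (by simp)
      have h2 := h1.hasFDerivAt.comp ((u, 0, 0) : CoordSpace m)
        (hasFDerivAt_prodMk_right s ((u, 0, 0) : CoordSpace m))
      rw [hA, HasFDerivAt.fderiv (f := fun y ↦ flowInCharts φ c d (s, y)) h2]
      rfl
    have hP := h.pullback_flowInCharts c d hz
    rw [← hA] at hP
    have htgt := d.coord_mem hz.2.2.2
    -- The axis is mapped into the axis, so the image of its tangent vector has no `v`- and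
    -- `y`-components.
    have hAu : A (1, 0, 0) = (A (1, 0, 0)).1 • ((1, 0, 0) : CoordSpace m) := by
      have h1 := (h.differentiableAt_flowInCharts c d hz).hasFDerivAt
      have h2 : HasDerivAt (fun t : ℝ ↦ ((t, 0, 0) : CoordSpace m)) (1, 0, 0) u :=
        (hasDerivAt_id u).prodMk (hasDerivAt_const u _)
      have h3 := (ContinuousLinearMap.snd ℝ ℝ
        (ℝ × EuclideanSpace ℝ (Fin m))).hasFDerivAt.comp_hasDerivAt u (h1.comp_hasDerivAt u h2)
      have h4 : HasDerivAt (fun _ : ℝ ↦ (0 : ℝ × EuclideanSpace ℝ (Fin m))) 0 u :=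
        hasDerivAt_const u _
      have hev : ∀ᶠ t : ℝ in 𝓝 u, (s, ((t, 0, 0) : CoordSpace m)) ∈ flowDomain φ σ c d :=
        ((h.isOpen_flowDomain c d).preimage
          (by fun_prop : Continuous fun t : ℝ ↦ (s, ((t, 0, 0) : CoordSpace m)))).mem_nhds hz
      have h5 := h3.unique (h4.congr_of_eventuallyEq (by
        filter_upwards [hev] with t ht
        simp [h.flowInCharts_axis c d ht.2.1 ht.2.2.1]))
      have h6 : (A (1, 0, 0)).2 = 0 := h5
      refine Prod.ext (by simp) ?_
      rw [h6]
      simp [Prod.ext_iff]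
    -- With `A ∂_u = k ∂_u`, invariance of `g(∂_u, Y)` reads `k dv(A Y) = dv(Y)`. Taking `Y = ∂_v`
    -- shows `k ≠ 0`, and `Y = (0, 0, y)` then gives the claim.
    have hk : ∀ Y : CoordSpace m, (A (1, 0, 0)).1 * ((A Y).2.1 / 2) = Y.2.1 / 2 := by
      intro Y
      have h1 := hP (1, 0, 0) Y
      rw [hAu, c.pullback_du hz.1, ← LorentzMetric.pullbackL_apply] at h1
      simp only [map_smul, smul_apply, LorentzMetric.pullbackL_apply] at h1
      rw [← h1]
      congr 1
      exact (d.pullback_du htgt _).symm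
    have h1 := hk (0, 1, 0)
    have h2 := hk (0, 0, y)
    rw [hA']
    have h3 : (A (1, 0, 0)).1 ≠ 0 := by
      intro h0
      rw [h0] at h1
      norm_num at h1
    simpa [h3] using h2

end Transition

/-! ### The limits of the rescaled isometries. -/

section LimitMap

variable {m : ℕ} {M : Type*} [TopologicalSpace M] [ChartedSpace (SpacetimeModel m) M]
  [IsManifold 𝓘(ℝ, SpacetimeModel m) ∞ M] {g : LorentzMetric m M} {γ : ℝ → M} {I : Set ℝ}
  {φ : ℝ → M → M} {σ : ℝ → ℝ → ℝ}

/-- The limit `lim_{Ω → 0} ψ_Ω⁻¹ ∘ (μ_d ∘ φ_s ∘ μ_c⁻¹) ∘ ψ_Ω`. -/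
noncomputable def limitMap (φ : ℝ → M → M) (c d : AdaptedChart g γ I) (z : ℝ × CoordSpace m) :
    CoordSpace m :=
  rescale (flowInCharts φ c d) (0, z)

variable (h : IsAxisFlow g γ I φ σ) (c d e : AdaptedChart g γ I)

include h

theorem IsAxisFlow.mem_rescaleDomain {s : ℝ} {x : CoordSpace m} (hx : x.1 ∈ c.interval)
    (hs : σ s x.1 ∈ d.interval) : (0, s, x) ∈ rescaleDomain (flowDomain φ σ c d) := by
  rw [rescaleDomain, mem_ofPred_eq, penroseScaling_zero_left]
  exact h.axis_mem_flowDomain c d hx hs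

theorem IsAxisFlow.rescaleDomain_mem_nhds {s : ℝ} {x : CoordSpace m} (hx : x.1 ∈ c.interval)
    (hs : σ s x.1 ∈ d.interval) : rescaleDomain (flowDomain φ σ c d) ∈ 𝓝 (0, s, x) :=
  (isOpen_rescaleDomain (h.isOpen_flowDomain c d)).mem_nhds (h.mem_rescaleDomain c d hx hs)

theorem IsAxisFlow.contDiffAt_rescale {s : ℝ} {x : CoordSpace m} (hx : x.1 ∈ c.interval)
    (hs : σ s x.1 ∈ d.interval) :
    ContDiffAt ℝ ∞ (rescale (flowInCharts φ c d)) (0, s, x) :=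
  (h.preservesAxis c d).contDiffOn_rescale.contDiffAt (h.rescaleDomain_mem_nhds c d hx hs)

theorem IsAxisFlow.contDiffAt_limitMap {s : ℝ} {x : CoordSpace m} (hx : x.1 ∈ c.interval)
    (hs : σ s x.1 ∈ d.interval) : ContDiffAt ℝ ∞ (limitMap φ c d) (s, x) :=
  (h.contDiffAt_rescale c d hx hs).comp (s, x) (contDiffAt_const.prodMk contDiffAt_id)

theorem IsAxisFlow.limitMap_fst {s : ℝ} {x : CoordSpace m} (hx : x.1 ∈ c.interval)
    (hs : σ s x.1 ∈ d.interval) : (limitMap φ c d (s, x)).1 = σ s x.1 := by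
  rw [limitMap, rescale_zero_fst, h.flowInCharts_axis c d hx hs]

theorem IsAxisFlow.limitMap_axis {s u : ℝ} (hu : u ∈ c.interval) (hs : σ s u ∈ d.interval) :
    limitMap φ c d (s, (u, 0, 0)) = (σ s u, 0, 0) := by
  rw [limitMap, rescale_axis (h.preservesAxis c d) (h.axis_mem_flowDomain c d hu hs),
    h.flowInCharts_axis c d hu hs]

theorem IsAxisFlow.eventually_mem_flowDomain {s : ℝ} {x : CoordSpace m} (hx : x.1 ∈ c.interval)
    (hs : σ s x.1 ∈ d.interval) :
    ∀ᶠ Ω : ℝ in 𝓝[>] 0, (s, penroseScaling Ω x) ∈ flowDomain φ σ c d := by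
  have hc : Tendsto (fun Ω : ℝ ↦ (Ω, s, x)) (𝓝[>] 0) (𝓝 (0, s, x)) :=
    (by fun_prop : Continuous fun Ω : ℝ ↦ (Ω, s, x)).continuousWithinAt
  exact hc.eventually (h.rescaleDomain_mem_nhds c d hx hs)

theorem IsAxisFlow.tendsto_rescale {s : ℝ} {x : CoordSpace m} (hx : x.1 ∈ c.interval)
    (hs : σ s x.1 ∈ d.interval) {y : ℝ → CoordSpace m} (hy : Tendsto y (𝓝[>] 0) (𝓝 x)) :
    Tendsto (fun Ω ↦ rescale (flowInCharts φ c d) (Ω, s, y Ω)) (𝓝[>] 0)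
      (𝓝 (limitMap φ c d (s, x))) := by
  refine (h.contDiffAt_rescale c d hx hs).continuousAt.tendsto.comp ?_
  exact Tendsto.prodMk_nhds nhdsWithin_le_nhds (tendsto_const_nhds.prodMk_nhds hy)

/-- For small `Ω > 0` the inner scalings cancel and the group law of `φ` gives the identity exactly.
Joint continuity in `(Ω, x)` lets the limit pass through the composition. -/
theorem IsAxisFlow.limitMap_limitMap {s t : ℝ} {x : CoordSpace m} (hx : x.1 ∈ c.interval)
    (hs : σ s x.1 ∈ d.interval) (ht : σ (t + s) x.1 ∈ e.interval) :
    limitMap φ d e (t, limitMap φ c d (s, x)) = limitMap φ c e (t + s, x) := by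
  have hF := h.limitMap_fst c d hx hs
  have hadd := h.add t s x.1 (c.interval_subset hx)
  have h1 := h.tendsto_rescale c d hx hs tendsto_const_nhds
  have h2 := h.tendsto_rescale d e (by rwa [hF]) (by rwa [hF, ← hadd]) h1
  refine tendsto_nhds_unique (h2.congr' ?_) (h.tendsto_rescale c e hx ht tendsto_const_nhds)
  filter_upwards [self_mem_nhdsWithin, h.eventually_mem_flowDomain c d hx hs] with Ω hΩ hmem
  have hΩ' : Ω ≠ 0 := ne_of_gt hΩ
  rw [rescale_of_ne _ hΩ', rescale_of_ne _ hΩ', rescale_of_ne _ hΩ',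
    penroseScaling_cancel_inv hΩ']
  simp only [flowInCharts]
  rw [d.symm_coord hmem.2.2.2, h.isometryGroup.add]

theorem IsAxisFlow.scaledMetric_rescale {Ω s : ℝ} (hΩ : Ω ≠ 0) {x : CoordSpace m}
    (hx : (s, penroseScaling Ω x) ∈ flowDomain φ σ c d) (X Y : CoordSpace m) :
    d.scaledMetric Ω (rescale (flowInCharts φ c d) (Ω, s, x))
      (fderiv ℝ (fun y ↦ rescale (flowInCharts φ c d) (Ω, s, y)) x X)
      (fderiv ℝ (fun y ↦ rescale (flowInCharts φ c d) (Ω, s, y)) x Y) =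
    c.scaledMetric Ω x X Y := by
  have h1 : HasFDerivAt (fun y ↦ rescale (flowInCharts φ c d) (Ω, s, y))
      ((penroseScalingL m Ω⁻¹).comp ((fderiv ℝ (fun y ↦ flowInCharts φ c d (s, y))
        (penroseScaling Ω x)).comp (penroseScalingL m Ω))) x := by
    have h2 := (h.differentiableAt_flowInCharts c d hx).hasFDerivAt.comp x
      (penroseScalingL m Ω).hasFDerivAt
    refine ((penroseScalingL m Ω⁻¹).hasFDerivAt.comp x h2).congr_of_eventuallyEq ?_
    exact .of_forall fun y ↦ rescale_of_ne _ hΩ s y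
  rw [h1.fderiv, rescale_of_ne _ hΩ]
  simp only [AdaptedChart.scaledMetric, ContinuousLinearMap.comp_apply, penroseScalingL_apply,
    penroseScaling_cancel_inv hΩ]
  rw [h.pullback_flowInCharts c d hx]

/-- The rescaled isometries preserve the rescaled metrics for `Ω > 0`. Smoothness up to `Ω = 0`
makes their differentials converge as well, so the identity passes to the limit. -/
theorem IsAxisFlow.limitForm_limitMap {s : ℝ} {x : CoordSpace m} (hx : x.1 ∈ c.interval)
    (hs : σ s x.1 ∈ d.interval) (X Y : CoordSpace m) :
    d.limitForm (σ s x.1) (fderiv ℝ (fun y ↦ limitMap φ c d (s, y)) x X)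
      (fderiv ℝ (fun y ↦ limitMap φ c d (s, y)) x Y) = c.limitForm x.1 X Y := by
  have hF := h.limitMap_fst c d hx hs
  have hsmooth := h.contDiffAt_rescale c d hx hs
  -- The differential in `x` is a restriction of the full differential in `(Ω, s, x)`, which is
  -- continuous at `Ω = 0`.
  have hpart : ∀ᶠ Ω : ℝ in 𝓝 0, ∀ X, fderiv ℝ (fun y ↦ rescale (flowInCharts φ c d) (Ω, s, y)) x X =
      fderiv ℝ (rescale (flowInCharts φ c d)) (Ω, s, x) (0, 0, X) := by
    have hev := (by fun_prop : Continuous fun Ω : ℝ ↦ (Ω, s, x)).tendsto 0 |>.eventually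
      (h.rescaleDomain_mem_nhds c d hx hs)
    filter_upwards [hev] with Ω hΩ X
    change (Ω, s, x) ∈ rescaleDomain (flowDomain φ σ c d) at hΩ
    have h1 := (((h.preservesAxis c d).contDiffOn_rescale.contDiffAt
      ((isOpen_rescaleDomain (h.isOpen_flowDomain c d)).mem_nhds hΩ)).differentiableAt
      (by simp)).hasFDerivAt
    have h2 := h1.comp x ((hasFDerivAt_prodMk_right Ω (s, x)).comp x
      (hasFDerivAt_prodMk_right s x))
    rw [HasFDerivAt.fderiv (f := fun y ↦ rescale (flowInCharts φ c d) (Ω, s, y)) h2]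
    rfl
  have hD : ∀ X, Tendsto (fun Ω : ℝ ↦
      fderiv ℝ (fun y ↦ rescale (flowInCharts φ c d) (Ω, s, y)) x X) (𝓝[>] 0)
      (𝓝 (fderiv ℝ (fun y ↦ limitMap φ c d (s, y)) x X)) := by
    intro X
    have h1 : ContinuousAt (fderiv ℝ (rescale (flowInCharts φ c d))) (0, s, x) :=
      (hsmooth.fderiv_right (m := 0) (by simp)).continuousAt
    have h2 : Tendsto (fun Ω : ℝ ↦ fderiv ℝ (rescale (flowInCharts φ c d)) (Ω, s, x)) (𝓝[>] 0)
        (𝓝 (fderiv ℝ (rescale (flowInCharts φ c d)) (0, s, x))) :=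
      h1.tendsto.comp
        (by fun_prop : Continuous fun Ω : ℝ ↦ (Ω, s, x)).continuousWithinAt
    have h3 := tendsto_clm_apply h2 (tendsto_const_nhds (x := ((0, 0, X) : ℝ × ℝ × CoordSpace m)))
    have h4 : fderiv ℝ (fun y ↦ limitMap φ c d (s, y)) x X =
        fderiv ℝ (rescale (flowInCharts φ c d)) (0, s, x) (0, 0, X) := hpart.self_of_nhds X
    rw [h4]
    refine h3.congr' ?_
    filter_upwards [nhdsWithin_le_nhds hpart] with Ω hΩ using (hΩ X).symm
  have h1 := d.tendsto_scaledMetric (x₀ := limitMap φ c d (s, x)) (by rwa [hF])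
    (h.tendsto_rescale c d hx hs tendsto_const_nhds) (hD X) (hD Y)
  rw [hF] at h1
  refine tendsto_nhds_unique (h1.congr' ?_) (c.tendsto_scaledMetric hx tendsto_const_nhds
    tendsto_const_nhds tendsto_const_nhds)
  filter_upwards [self_mem_nhdsWithin, h.eventually_mem_flowDomain c d hx hs] with Ω hΩ hmem
  exact h.scaledMetric_rescale c d (ne_of_gt hΩ) hmem X Y

end LimitMap

/-! ### The induced one-parameter group on the Penrose limit. -/

namespace PenroseLimit

variable {m : ℕ} {M : Type*} [TopologicalSpace M] [ChartedSpace (SpacetimeModel m) M]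
  [IsManifold 𝓘(ℝ, SpacetimeModel m) ∞ M]
  {N : Type*} [TopologicalSpace N] [ChartedSpace (SpacetimeModel m) N]
  [IsManifold 𝓘(ℝ, SpacetimeModel m) ∞ N]
  {g : LorentzMetric m M} {γ : ℝ → M} {I : Set ℝ} {ι : Type*} (L : PenroseLimit g γ I ι N)
  {φ : ℝ → M → M} {σ : ℝ → ℝ → ℝ}

theorem mem_patch_source {a : ι} {x : CoordSpace m} :
    x ∈ (L.patch a).source ↔ x.1 ∈ (L.chart a).interval := by
  rw [L.patch_source a]; rfl

theorem contMDiffAt_patch {a : ι} {x : CoordSpace m} (hx : x.1 ∈ (L.chart a).interval) :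
    ContMDiffAt 𝓘(ℝ, CoordSpace m) 𝓘(ℝ, SpacetimeModel m) ∞ (L.patch a) x :=
  (L.patch a).contMDiffOn_toFun.contMDiffAt
    ((L.patch a).open_source.mem_nhds (L.mem_patch_source.2 hx))

theorem mdifferentiableAt_patch {a : ι} {x : CoordSpace m} (hx : x.1 ∈ (L.chart a).interval) :
    MDifferentiableAt 𝓘(ℝ, CoordSpace m) 𝓘(ℝ, SpacetimeModel m) (L.patch a) x :=
  (L.contMDiffAt_patch hx).mdifferentiableAt (by simp)

theorem patch_mem {a : ι} {x : CoordSpace m} (hx : x.1 ∈ (L.chart a).interval) :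
    L.patch a x ∈ (L.patch a).target :=
  (L.patch a).map_source (L.mem_patch_source.2 hx)

theorem symm_patch {a : ι} {x : CoordSpace m} (hx : x.1 ∈ (L.chart a).interval) :
    (L.patch a).symm (L.patch a x) = x :=
  (L.patch a).left_inv (L.mem_patch_source.2 hx)

theorem symm_mem {a : ι} {q : N} (hq : q ∈ (L.patch a).target) :
    ((L.patch a).symm q).1 ∈ (L.chart a).interval :=
  L.mem_patch_source.1 ((L.patch a).map_target hq)

theorem patch_symm {a : ι} {q : N} (hq : q ∈ (L.patch a).target) :
    L.patch a ((L.patch a).symm q) = q :=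
  (L.patch a).right_inv hq

theorem exists_patch (q : N) :
    ∃ a, ∃ x : CoordSpace m, x.1 ∈ (L.chart a).interval ∧ L.patch a x = q := by
  obtain ⟨a, ha⟩ := L.patch_covers q
  exact ⟨a, _, L.symm_mem ha, L.patch_symm ha⟩

theorem pullback_patch {a : ι} {x : CoordSpace m} (hx : x.1 ∈ (L.chart a).interval)
    (X Y : CoordSpace m) :
    L.metric.pullback (L.patch a) x X Y = (L.chart a).limitForm x.1 X Y :=
  tendsto_nhds_unique (L.patch_metric a x (L.mem_patch_source.2 hx) X Y)
    ((L.chart a).tendsto_scaledMetric hx tendsto_const_nhds tendsto_const_nhds tendsto_const_nhds)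

theorem mfderiv_patch_injective {a : ι} {x : CoordSpace m} (hx : x.1 ∈ (L.chart a).interval) :
    Function.Injective (mfderiv 𝓘(ℝ, CoordSpace m) 𝓘(ℝ, SpacetimeModel m) (L.patch a) x) := by
  have h1 : MDifferentiableAt 𝓘(ℝ, SpacetimeModel m) 𝓘(ℝ, CoordSpace m) (L.patch a).symm
      (L.patch a x) :=
    ((L.patch a).contMDiffOn_invFun.contMDiffAt
      ((L.patch a).open_target.mem_nhds (L.patch_mem hx))).mdifferentiableAt (by simp)
  have h2 := mfderiv_comp x h1 (L.mdifferentiableAt_patch hx)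
  have h3 : (L.patch a).symm ∘ L.patch a =ᶠ[𝓝 x] id := by
    filter_upwards [(L.patch a).open_source.mem_nhds (L.mem_patch_source.2 hx)] with y hy
      using (L.patch a).left_inv hy
  rw [h3.mfderiv_eq, mfderiv_id] at h2
  intro X Y hXY
  have h4 : ∀ Z : CoordSpace m, Z = (mfderiv 𝓘(ℝ, SpacetimeModel m) 𝓘(ℝ, CoordSpace m)
      (L.patch a).symm (L.patch a x)) (mfderiv 𝓘(ℝ, CoordSpace m) 𝓘(ℝ, SpacetimeModel m)
        (L.patch a) x Z) := fun Z ↦ congrArg (fun A : CoordSpace m →L[ℝ] CoordSpace m ↦ A Z) h2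
  exact (h4 X).trans ((congrArg _ hXY).trans (h4 Y).symm)

theorem mfderiv_patch_surjective {a : ι} {x : CoordSpace m} (hx : x.1 ∈ (L.chart a).interval) :
    Function.Surjective (mfderiv 𝓘(ℝ, CoordSpace m) 𝓘(ℝ, SpacetimeModel m) (L.patch a) x) := by
  let A : CoordSpace m →L[ℝ] SpacetimeModel m :=
    mfderiv 𝓘(ℝ, CoordSpace m) 𝓘(ℝ, SpacetimeModel m) (L.patch a) x
  have hA : Function.Injective (A : CoordSpace m →ₗ[ℝ] SpacetimeModel m) :=
    L.mfderiv_patch_injective hx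
  have hdim : Module.finrank ℝ (CoordSpace m) = Module.finrank ℝ (SpacetimeModel m) := by
    simp
    omega
  have hs : Function.Surjective (A : CoordSpace m →ₗ[ℝ] SpacetimeModel m) :=
    (LinearMap.injective_iff_surjective_of_finrank_eq_finrank hdim).1 hA
  exact hs

/-- Since `φ_0` is the identity, the limiting coordinate change is the limit map at `s = 0`. Changes
of patch thereby become instances of the group law. -/
theorem glue (h : IsAxisFlow g γ I φ σ) {a b : ι} {x : CoordSpace m}
    (ha : x.1 ∈ (L.chart a).interval) (hb : x.1 ∈ (L.chart b).interval) :
    L.patch a x = L.patch b (limitMap φ (L.chart a) (L.chart b) (0, x)) := by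
  obtain ⟨y, -, hxy, hy⟩ := L.patch_glue a b x (L.mem_patch_source.2 ha) hb
  have h0 : σ 0 x.1 ∈ (L.chart b).interval := by
    rwa [h.zero _ ((L.chart a).interval_subset ha)]
  rw [hxy]
  congr 1
  refine tendsto_nhds_unique (hy.congr' ?_) (h.tendsto_rescale _ _ ha h0 tendsto_const_nhds)
  filter_upwards [self_mem_nhdsWithin] with Ω hΩ
  rw [rescale_of_ne _ (ne_of_gt hΩ), flowInCharts, h.isometryGroup.zero]

open Classical in
/-- The one-parameter group induced on the Penrose limit by the one-parameter group `φ`. -/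
noncomputable def flow (φ : ℝ → M → M) (σ : ℝ → ℝ → ℝ) (s : ℝ) (q : N) : N :=
  if hs : ∃ b, σ s ((L.patch (L.patch_covers q).choose).symm q).1 ∈ (L.chart b).interval then
    L.patch hs.choose (limitMap φ (L.chart (L.patch_covers q).choose) (L.chart hs.choose)
      (s, (L.patch (L.patch_covers q).choose).symm q))
  else q

/-- The patches chosen in `flow` do not matter: replacing either one inserts a limit map at time
`0`, which `IsAxisFlow.limitMap_limitMap` absorbs. The default value is not reached, because `σ`
preserves `I` and the charts cover it. -/
theorem flow_patch (h : IsAxisFlow g γ I φ σ) {a b : ι} {s : ℝ} {x : CoordSpace m}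
    (hx : x.1 ∈ (L.chart a).interval) (hs : σ s x.1 ∈ (L.chart b).interval) :
    L.flow φ σ s (L.patch a x) = L.patch b (limitMap φ (L.chart a) (L.chart b) (s, x)) := by
  set c := (L.patch_covers (L.patch a x)).choose with hc
  set y := (L.patch c).symm (L.patch a x) with hy
  have hmem : L.patch a x ∈ (L.patch c).target := (L.patch_covers (L.patch a x)).choose_spec
  have hyc : y.1 ∈ (L.chart c).interval := L.symm_mem hmem
  have hyp : L.patch c y = L.patch a x := L.patch_symm hmem
  -- Gluing happens only over equal `u`, so `x` lies over the chosen patch too and `glue` relates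
  -- `x` to `y`.
  have hxy : y.1 = x.1 := L.patch_separated c a y (L.mem_patch_source.2 hyc) x
    (L.mem_patch_source.2 hx) hyp
  have hyI : y.1 ∈ I := (L.chart c).interval_subset hyc
  have hex : ∃ b, σ s y.1 ∈ (L.chart b).interval := L.covers _ (h.mapsTo s _ hyI)
  rw [flow, dif_pos hex]
  set d := hex.choose
  have hd : σ s y.1 ∈ (L.chart d).interval := hex.choose_spec
  have hxc : x.1 ∈ (L.chart c).interval := by rwa [← hxy]
  have h0 : σ 0 x.1 = x.1 := h.zero _ ((L.chart a).interval_subset hx)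
  have hyl : y = limitMap φ (L.chart a) (L.chart c) (0, x) := by
    rw [hy, L.glue h hx hxc, L.symm_patch]
    rw [h.limitMap_fst _ _ hx (by rwa [h0]), h0]
    exact hxc
  have hF := h.limitMap_fst _ _ hyc hd
  have hb' : (limitMap φ (L.chart c) (L.chart d) (s, y)).1 ∈ (L.chart b).interval := by
    rwa [hF, hxy]
  change L.patch d (limitMap φ (L.chart c) (L.chart d) (s, y)) = _
  rw [L.glue h (by rwa [hF]) hb', h.limitMap_limitMap _ _ _ hyc hd (by rwa [zero_add, hxy]),
    hyl, h.limitMap_limitMap _ _ _ hx (by rwa [h0]) (by rwa [zero_add, add_zero]), zero_add,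
    add_zero]

theorem flow_curve (h : IsAxisFlow g γ I φ σ) (s : ℝ) {u : ℝ} (hu : u ∈ I) :
    L.flow φ σ s (L.curve u) = L.curve (σ s u) := by
  obtain ⟨a, ha⟩ := L.covers u hu
  obtain ⟨b, hb⟩ := L.covers _ (h.mapsTo s u hu)
  rw [← L.patch_curve a u ha, L.flow_patch h ha hb, h.limitMap_axis _ _ ha hb,
    L.patch_curve b _ hb]

theorem flow_zero (h : IsAxisFlow g γ I φ σ) (q : N) : L.flow φ σ 0 q = q := by
  obtain ⟨a, x, hx, rfl⟩ := L.exists_patch q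
  rw [L.flow_patch h hx (by rwa [h.zero _ ((L.chart a).interval_subset hx)]), ← L.glue h hx hx]

theorem flow_add (h : IsAxisFlow g γ I φ σ) (s t : ℝ) (q : N) :
    L.flow φ σ (s + t) q = L.flow φ σ s (L.flow φ σ t q) := by
  obtain ⟨a, x, hx, rfl⟩ := L.exists_patch q
  have hI := (L.chart a).interval_subset hx
  obtain ⟨b, hb⟩ := L.covers _ (h.mapsTo t _ hI)
  obtain ⟨c, hc⟩ := L.covers _ (h.mapsTo (s + t) _ hI)
  have hF := h.limitMap_fst _ _ hx hb
  rw [L.flow_patch h hx hb, L.flow_patch h hx hc, L.flow_patch h (b := c) (by rwa [hF])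
    (by rwa [hF, ← h.add s t _ hI]), h.limitMap_limitMap _ _ _ hx hb hc]

theorem contMDiff_flow (h : IsAxisFlow g γ I φ σ) :
    ContMDiff (𝓘(ℝ, ℝ).prod 𝓘(ℝ, SpacetimeModel m)) 𝓘(ℝ, SpacetimeModel m) ∞
      (fun z : ℝ × N ↦ L.flow φ σ z.1 z.2) := by
  rintro ⟨s, q⟩
  obtain ⟨a, x, hx, rfl⟩ := L.exists_patch q
  have hI := (L.chart a).interval_subset hx
  obtain ⟨b, hb⟩ := L.covers _ (h.mapsTo s _ hI)
  have hsymm : ContMDiffAt 𝓘(ℝ, SpacetimeModel m) 𝓘(ℝ, CoordSpace m) ∞ (L.patch a).symm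
      (L.patch a x) := (L.patch a).contMDiffOn_invFun.contMDiffAt
    ((L.patch a).open_target.mem_nhds (L.patch_mem hx))
  have hpair : ContMDiffAt (𝓘(ℝ, ℝ).prod 𝓘(ℝ, SpacetimeModel m)) 𝓘(ℝ, ℝ × CoordSpace m) ∞
      (fun z : ℝ × N ↦ (z.1, (L.patch a).symm z.2)) (s, L.patch a x) :=
    contMDiffAt_fst.prodMk_space (ContMDiffAt.comp (s, L.patch a x) hsymm contMDiffAt_snd)
  have hmap : ContMDiffAt 𝓘(ℝ, ℝ × CoordSpace m) 𝓘(ℝ, SpacetimeModel m) ∞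
      (fun z ↦ L.patch b (limitMap φ (L.chart a) (L.chart b) z)) (s, x) := by
    refine ContMDiffAt.comp (s, x) (L.contMDiffAt_patch ?_)
      (h.contDiffAt_limitMap _ _ hx hb).contMDiffAt
    rwa [h.limitMap_fst _ _ hx hb]
  have hmap' : ContMDiffAt 𝓘(ℝ, ℝ × CoordSpace m) 𝓘(ℝ, SpacetimeModel m) ∞
      (fun z ↦ L.patch b (limitMap φ (L.chart a) (L.chart b) z))
      (s, (L.patch a).symm (L.patch a x)) := by rwa [L.symm_patch hx]
  refine (ContMDiffAt.comp (s, L.patch a x) hmap' hpair).congr_of_eventuallyEq ?_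
  -- By continuity of `σ`, the same two patches serve all nearby times and points.
  have hopen := h.isOpen_pairs _ _ (L.chart a).isOpen_interval (L.chart a).interval_subset
    (L.chart b).isOpen_interval
  have hc : Tendsto (fun z : ℝ × N ↦ (z.1, ((L.patch a).symm z.2).1)) (𝓝 (s, L.patch a x))
      (𝓝 (s, x.1)) := by
    have := hpair.continuousAt.tendsto
    rw [L.symm_patch hx] at this
    exact this.fst_nhds.prodMk_nhds this.snd_nhds.fst_nhds
  have ht : ∀ᶠ z : ℝ × N in 𝓝 (s, L.patch a x), z.2 ∈ (L.patch a).target :=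
    continuousAt_snd.eventually ((L.patch a).open_target.mem_nhds (L.patch_mem hx))
  filter_upwards [ht, hc.eventually (hopen.mem_nhds ⟨hx, hb⟩)] with z hz hz'
  exact (congrArg _ (L.patch_symm hz).symm).trans (L.flow_patch h hz'.1 hz'.2)

/-- Every tangent vector comes from a patch, so it suffices to compare pullbacks to patches; there
the claim is `IsAxisFlow.limitForm_limitMap`. -/
theorem flow_isometry (h : IsAxisFlow g γ I φ σ) (s : ℝ) (q : N)
    (X Y : TangentSpace 𝓘(ℝ, SpacetimeModel m) q) :
    L.metric.val (L.flow φ σ s q)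
      (mfderiv 𝓘(ℝ, SpacetimeModel m) 𝓘(ℝ, SpacetimeModel m) (L.flow φ σ s) q X)
      (mfderiv 𝓘(ℝ, SpacetimeModel m) 𝓘(ℝ, SpacetimeModel m) (L.flow φ σ s) q Y) =
      L.metric.val q X Y := by
  obtain ⟨a, x, hx, rfl⟩ := L.exists_patch q
  have hI := (L.chart a).interval_subset hx
  obtain ⟨b, hb⟩ := L.covers _ (h.mapsTo s _ hI)
  obtain ⟨X, rfl⟩ := L.mfderiv_patch_surjective hx X
  obtain ⟨Y, rfl⟩ := L.mfderiv_patch_surjective hx Y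
  have hd : MDifferentiableAt 𝓘(ℝ, SpacetimeModel m) 𝓘(ℝ, SpacetimeModel m) (L.flow φ σ s)
      (L.patch a x) :=
    ContMDiffAt.mdifferentiableAt (n := ∞) (((L.contMDiff_flow h).comp
      (contMDiff_const.prodMk contMDiff_id) : ContMDiff 𝓘(ℝ, SpacetimeModel m)
        𝓘(ℝ, SpacetimeModel m) ∞ (L.flow φ σ s)) _) (by simp)
  have hcomp := mfderiv_comp x hd (L.mdifferentiableAt_patch hx)
  have hF := h.limitMap_fst _ _ hx hb
  have hb' : (limitMap φ (L.chart a) (L.chart b) (s, x)).1 ∈ (L.chart b).interval := by rwa [hF]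
  have hdl : DifferentiableAt ℝ (fun y ↦ limitMap φ (L.chart a) (L.chart b) (s, y)) x :=
    ((h.contDiffAt_limitMap _ _ hx hb).differentiableAt (by simp)).comp x
      ((differentiableAt_const s).prodMk differentiableAt_id)
  have hev : L.flow φ σ s ∘ L.patch a =ᶠ[𝓝 x]
      L.patch b ∘ fun y ↦ limitMap φ (L.chart a) (L.chart b) (s, y) := by
    have hopen := h.isOpen_pairs _ _ (L.chart a).isOpen_interval (L.chart a).interval_subset
      (L.chart b).isOpen_interval
    have hc : Continuous fun y : CoordSpace m ↦ (s, y.1) := by fun_prop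
    filter_upwards [hc.continuousAt.eventually (hopen.mem_nhds ⟨hx, hb⟩)] with y hy
      using L.flow_patch h hy.1 hy.2
  have h1 : L.metric.pullback (L.flow φ σ s ∘ L.patch a) x X Y =
      L.metric.pullback (L.patch a) x X Y := by
    refine (L.metric.pullback_congr hev X Y).trans ((L.metric.pullback_comp
      (h := fun y ↦ limitMap φ (L.chart a) (L.chart b) (s, y))
      (L.mdifferentiableAt_patch hb') hdl X Y).trans ?_)
    rw [L.pullback_patch hb', hF]
    exact (h.limitForm_limitMap _ _ hx hb X Y).trans (L.pullback_patch hx X Y).symm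
  unfold LorentzMetric.pullback at h1
  rw [hcomp] at h1
  exact h1

theorem isOneParameterIsometryGroup_flow (h : IsAxisFlow g γ I φ σ) :
    IsOneParameterIsometryGroup L.metric (L.flow φ σ) where
  smooth := L.contMDiff_flow h
  zero := L.flow_zero h
  add := L.flow_add h
  isometry := L.flow_isometry h

end PenroseLimit

/-! ### The limit curve is a geodesic. -/

/-- If the components `(θ^* G)(e, ·)` of the pullback of a metric `G` are constant, then the
`e`-line through `x` is mapped by `θ` to a solution of the geodesic equation at `x`, written with
lowered index. -/
theorem geodesic_identity {E F : Type*} [NormedAddCommGroup E] [NormedSpace ℝ E]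
    [NormedAddCommGroup F] [NormedSpace ℝ F] {θ : E → F} {G : F → F →L[ℝ] F →L[ℝ] ℝ} {x e : E}
    (hθ : ContDiffAt ℝ ∞ θ x) (hG : DifferentiableAt ℝ G (θ x))
    (hsymm : ∀ y A B, G y A B = G y B A) {κ : E → ℝ}
    (hκ : ∀ W, ∀ᶠ y in 𝓝 x, G (θ y) (fderiv ℝ θ y e) (fderiv ℝ θ y W) = κ W) (W : E) :
    G (θ x) (fderiv ℝ (fderiv ℝ θ) x e e) (fderiv ℝ θ x W)
      + fderiv ℝ G (θ x) (fderiv ℝ θ x e) (fderiv ℝ θ x e) (fderiv ℝ θ x W)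
      - fderiv ℝ G (θ x) (fderiv ℝ θ x W) (fderiv ℝ θ x e) (fderiv ℝ θ x e) / 2 = 0 := by
  have h2 : HasFDerivAt (fderiv ℝ θ) (fderiv ℝ (fderiv ℝ θ) x) x :=
    ((hθ.fderiv_right (m := ∞) (by simp)).differentiableAt (by simp)).hasFDerivAt
  have h1 : HasFDerivAt θ (fderiv ℝ θ x) x := (hθ.differentiableAt (by simp)).hasFDerivAt
  have hGθ : HasFDerivAt (fun y ↦ G (θ y)) ((fderiv ℝ G (θ x)).comp (fderiv ℝ θ x)) x :=
    HasFDerivAt.comp (g := G) x hG.hasFDerivAt h1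
  have hsnd : fderiv ℝ (fderiv ℝ θ) x W e = fderiv ℝ (fderiv ℝ θ) x e W :=
    (hθ.isSymmSndFDerivAt (by
      rw [minSmoothness_of_isRCLikeNormedField]; exact WithTop.coe_le_coe.2 le_top)).eq W e
  -- This is the derivative of the constant function `G(θ' e, θ' U)` in the direction `V`.
  have key : ∀ V U : E, fderiv ℝ G (θ x) (fderiv ℝ θ x V) (fderiv ℝ θ x e) (fderiv ℝ θ x U)
      + G (θ x) (fderiv ℝ (fderiv ℝ θ) x V e) (fderiv ℝ θ x U)
      + G (θ x) (fderiv ℝ θ x e) (fderiv ℝ (fderiv ℝ θ) x V U) = 0 := by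
    intro V U
    have h3 := (hGθ.clm_apply (h2.clm_apply (hasFDerivAt_const e x))).clm_apply
      (h2.clm_apply (hasFDerivAt_const U x))
    have h4 := h3.unique ((hasFDerivAt_const (κ U) x).congr_of_eventuallyEq (hκ U))
    have h5 := congrArg (fun A : E →L[ℝ] ℝ ↦ A V) h4
    simp at h5
    linarith
  -- Subtracting half of the second identity from the first eliminates the mixed second derivative
  -- of `θ`.
  have h3 := key e W
  have h4 := key W e
  rw [hsymm _ (fderiv ℝ θ x e), hsnd] at h4
  rw [hsymm _ (fderiv ℝ θ x e)] at h3
  linarith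

namespace PenroseLimit

variable {m : ℕ} {M : Type*} [TopologicalSpace M] [ChartedSpace (SpacetimeModel m) M]
  [IsManifold 𝓘(ℝ, SpacetimeModel m) ∞ M]
  {N : Type*} [TopologicalSpace N] [ChartedSpace (SpacetimeModel m) N]
  [IsManifold 𝓘(ℝ, SpacetimeModel m) ∞ N]
  {g : LorentzMetric m M} {γ : ℝ → M} {I : Set ℝ} {ι : Type*} (L : PenroseLimit g γ I ι N)

theorem curve_eventuallyEq {a : ι} {u : ℝ} (hu : u ∈ (L.chart a).interval) :
    L.curve =ᶠ[𝓝 u] L.patch a ∘ fun t : ℝ ↦ ((t, 0, 0) : CoordSpace m) := by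
  filter_upwards [(L.chart a).isOpen_interval.mem_nhds hu] with t ht
    using (L.patch_curve a t ht).symm

theorem contMDiffAt_curve {u : ℝ} (hu : u ∈ I) :
    ContMDiffAt 𝓘(ℝ, ℝ) 𝓘(ℝ, SpacetimeModel m) ∞ L.curve u := by
  obtain ⟨a, ha⟩ := L.covers u hu
  refine ContMDiffAt.congr_of_eventuallyEq ?_ (L.curve_eventuallyEq ha)
  refine ContMDiffAt.comp u (L.contMDiffAt_patch (x := (u, 0, 0)) ha) (ContDiffAt.contMDiffAt ?_)
  fun_prop

theorem velocity_curve_ne_zero {u : ℝ} (hu : u ∈ I) : velocity (m := m) L.curve u ≠ 0 := by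
  obtain ⟨a, ha⟩ := L.covers u hu
  have hax : HasFDerivAt (fun t : ℝ ↦ ((t, 0, 0) : CoordSpace m))
      (ContinuousLinearMap.inl ℝ ℝ (ℝ × EuclideanSpace ℝ (Fin m))) u :=
    hasFDerivAt_prodMk_left u _
  intro h0
  rw [velocity, (L.curve_eventuallyEq ha).mfderiv_eq, mfderiv_comp u
    (L.mdifferentiableAt_patch (x := (u, 0, 0)) ha) hax.differentiableAt.mdifferentiableAt,
    mfderiv_eq_fderiv, hax.fderiv] at h0
  have h1 := L.mfderiv_patch_injective (x := (u, 0, 0)) ha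
    (a₁ := ((1, 0, 0) : CoordSpace m)) (a₂ := (0 : CoordSpace m)) (h0.trans (map_zero _).symm)
  have h2 := congrArg Prod.fst h1
  simp at h2

theorem limitForm_du {c : AdaptedChart g γ I} (u : ℝ) (Y : CoordSpace m) :
    c.limitForm u (1, 0, 0) Y = Y.2.1 / 2 := by
  have : ((0, 0, 0) : CoordSpace m) = 0 := rfl
  simp [AdaptedChart.limitForm, this]

-- Let `θ` be a patch read in the preferred chart. The curve is the image of the `u`-axis under `θ`,
-- and `limitForm_du` gives the constant components `dv / 2` required by `geodesic_identity`. The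
-- geodesic equation of `γ` in `M` plays no role.
set_option maxHeartbeats 400000 in
theorem geodesic_eq_curve {u : ℝ} (hu : u ∈ I) (Z : SpacetimeModel m) :
    let c : ℝ → SpacetimeModel m := fun s ↦ chartAt (SpacetimeModel m) (L.curve u) (L.curve s)
    L.metric.inChart (L.curve u) (c u) (deriv (deriv c) u) Z +
      L.metric.christoffel (L.curve u) (c u) (deriv c u) (deriv c u) Z = 0 := by
  intro c
  obtain ⟨a, ha⟩ := L.covers u hu
  set χ := chartAt (SpacetimeModel m) (L.curve u) with hχ
  let x₀ : CoordSpace m := (u, 0, 0)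
  have hx₀ : x₀.1 ∈ (L.chart a).interval := ha
  have hpu : L.patch a x₀ = L.curve u := L.patch_curve a u ha
  have hus : L.curve u ∈ χ.source := mem_chart_source _ _
  let θ : CoordSpace m → SpacetimeModel m := fun x ↦ χ (L.patch a x)
  have hχs : ContMDiffOn 𝓘(ℝ, SpacetimeModel m) 𝓘(ℝ, SpacetimeModel m) ∞ χ.symm χ.target :=
    contMDiffOn_chart_symm
  have hχc : ContMDiffOn 𝓘(ℝ, SpacetimeModel m) 𝓘(ℝ, SpacetimeModel m) ∞ χ χ.source :=
    contMDiffOn_chart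
  have hnear : ∀ᶠ x in 𝓝 x₀, x.1 ∈ (L.chart a).interval ∧ L.patch a x ∈ χ.source := by
    have h1 : Tendsto (L.patch a) (𝓝 x₀) (𝓝 (L.curve u)) := by
      rw [← hpu]
      exact (L.contMDiffAt_patch hx₀).continuousAt
    have h2 : Tendsto (fun x : CoordSpace m ↦ x.1) (𝓝 x₀) (𝓝 u) := continuous_fst.tendsto x₀
    exact (h2.eventually ((L.chart a).isOpen_interval.mem_nhds ha)).and
      (h1.eventually (χ.open_source.mem_nhds hus))
  have hθat : ∀ x : CoordSpace m, x.1 ∈ (L.chart a).interval → L.patch a x ∈ χ.source →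
      ContDiffAt ℝ ∞ θ x := fun x hx hx' ↦
    (ContMDiffAt.comp x (hχc.contMDiffAt (χ.open_source.mem_nhds hx'))
      (L.contMDiffAt_patch hx)).contDiffAt
  have hθ₀ : ContDiffAt ℝ ∞ θ x₀ := hθat x₀ hx₀ (by rwa [hpu])
  have hθu : θ x₀ = c u := by simp only [θ, c, hpu, hχ]
  have htgt : c u ∈ χ.target := χ.map_source hus
  let G : SpacetimeModel m → SpacetimeModel m →L[ℝ] SpacetimeModel m →L[ℝ] ℝ :=
    L.metric.pullbackL χ.symm
  have hG : DifferentiableAt ℝ G (c u) :=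
    ((L.metric.contDiffOn_pullbackL χ.open_target hχs).contDiffAt
      (χ.open_target.mem_nhds htgt)).differentiableAt (by simp)
  have hpull : ∀ᶠ x in 𝓝 x₀, ∀ W, G (θ x) (fderiv ℝ θ x (1, 0, 0)) (fderiv ℝ θ x W) =
      W.2.1 / 2 := by
    filter_upwards [hnear.eventually_nhds] with x hx W
    have hx' := hx.self_of_nhds
    rw [← limitForm_du (c := L.chart a) x.1, ← L.pullback_patch hx'.1]
    have h1 : MDifferentiableAt 𝓘(ℝ, SpacetimeModel m) 𝓘(ℝ, SpacetimeModel m) χ.symm (θ x) :=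
      (hχs.contMDiffAt (χ.open_target.mem_nhds (χ.map_source hx'.2))).mdifferentiableAt (by simp)
    have h2 : DifferentiableAt ℝ θ x := (hθat x hx'.1 hx'.2).differentiableAt (by simp)
    have h3 := L.metric.pullback_comp h1 h2 (1, 0, 0) W
    have h4 : χ.symm ∘ θ =ᶠ[𝓝 x] L.patch a := by
      filter_upwards [hx] with y hy using χ.left_inv hy.2
    rw [L.metric.pullback_congr h4] at h3
    exact (L.metric.pullbackL_apply _ _ _ _).trans h3.symm
  have hGs : ∀ y A B, G y A B = G y B A := L.metric.pullbackL_symm χ.symm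
  have hgeo := fun W ↦ geodesic_identity (x := x₀) (e := ((1, 0, 0) : CoordSpace m)) hθ₀
    (by rw [hθu]; exact hG) hGs
    (κ := fun W ↦ W.2.1 / 2) (fun W ↦ hpull.mono fun x hx ↦ hx W) W
  have hax : ∀ t : ℝ, HasDerivAt (fun t : ℝ ↦ ((t, 0, 0) : CoordSpace m)) (1, 0, 0) t :=
    fun t ↦ (hasDerivAt_id t).prodMk (hasDerivAt_const t _)
  have haxc : ContinuousAt (fun t : ℝ ↦ ((t, 0, 0) : CoordSpace m)) u :=
    (hax u).continuousAt
  have hnearu : ∀ᶠ t : ℝ in 𝓝 u, ((t, 0, 0) : CoordSpace m).1 ∈ (L.chart a).interval ∧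
      L.patch a (t, 0, 0) ∈ χ.source := haxc.eventually hnear
  have hder : deriv c =ᶠ[𝓝 u] fun t ↦ fderiv ℝ θ (t, 0, 0) (1, 0, 0) := by
    filter_upwards [hnearu] with t ht
    have h1 := ((hθat _ ht.1 ht.2).differentiableAt (by simp)).hasFDerivAt.comp_hasDerivAt t (hax t)
    refine (h1.congr_of_eventuallyEq ?_).deriv
    filter_upwards [L.curve_eventuallyEq ht.1] with s hs
    simp only [c, hs, θ, Function.comp_apply, hχ]
  have hder2 : deriv (deriv c) u = fderiv ℝ (fderiv ℝ θ) x₀ (1, 0, 0) (1, 0, 0) := by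
    have h1 : HasFDerivAt (fderiv ℝ θ) (fderiv ℝ (fderiv ℝ θ) x₀) x₀ :=
      ((hθ₀.fderiv_right (m := ∞) (by simp)).differentiableAt (by simp)).hasFDerivAt
    have h2 : HasFDerivAt (fun x ↦ fderiv ℝ θ x (1, 0, 0))
        ((fderiv ℝ (fderiv ℝ θ) x₀).flip (1, 0, 0)) x₀ := by
      simpa using h1.clm_apply (hasFDerivAt_const ((1, 0, 0) : CoordSpace m) x₀)
    have h3 := h2.comp_hasDerivAt u (hax u)
    exact (h3.congr_of_eventuallyEq hder).deriv
  -- The identity tests only against vectors `θ' W`; these are all vectors, because `θ` has a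
  -- differentiable local right inverse.
  have hZ : ∃ W, fderiv ℝ θ x₀ W = Z := by
    let ρ : SpacetimeModel m → CoordSpace m := fun y ↦ (L.patch a).symm (χ.symm y)
    have hback : χ.symm (c u) = L.patch a x₀ := by rw [hpu]; exact χ.left_inv hus
    have hρu : ρ (c u) = x₀ := by
      simp only [ρ, hback]
      exact L.symm_patch hx₀
    have hps : ContMDiffAt 𝓘(ℝ, SpacetimeModel m) 𝓘(ℝ, CoordSpace m) ∞ (L.patch a).symm
        (χ.symm (c u)) := by
      rw [hback]
      exact (L.patch a).contMDiffOn_invFun.contMDiffAt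
        ((L.patch a).open_target.mem_nhds (L.patch_mem hx₀))
    have hχu := hχs.contMDiffAt (χ.open_target.mem_nhds htgt)
    have hρ : DifferentiableAt ℝ ρ (c u) :=
      (ContMDiffAt.comp (c u) hps hχu).contDiffAt.differentiableAt (by simp)
    have hθ' : DifferentiableAt ℝ θ (ρ (c u)) := by
      rw [hρu]; exact hθ₀.differentiableAt (by simp)
    have hid : θ ∘ ρ =ᶠ[𝓝 (c u)] id := by
      have h1 : ∀ᶠ y in 𝓝 (c u), χ.symm y ∈ (L.patch a).target := by
        refine hχu.continuousAt.eventually ((L.patch a).open_target.mem_nhds ?_)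
        rw [hback]
        exact L.patch_mem hx₀
      filter_upwards [h1, χ.open_target.mem_nhds htgt] with y hy hy'
      simp only [θ, ρ, Function.comp_apply, L.patch_symm hy, χ.right_inv hy', id]
    have h1 := fderiv_comp (c u) hθ' hρ
    rw [hid.fderiv_eq, fderiv_id, hρu] at h1
    exact ⟨fderiv ℝ ρ (c u) Z,
      (congrArg (fun A : SpacetimeModel m →L[ℝ] SpacetimeModel m ↦ A Z) h1).symm⟩
  obtain ⟨W, rfl⟩ := hZ
  have hGd : ∀ A B C, fderiv ℝ (fun y ↦ L.metric.inChart (L.curve u) y A B) (c u) C =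
      fderiv ℝ G (c u) C A B := by
    intro A B C
    have h1 := (hG.hasFDerivAt.clm_apply (hasFDerivAt_const A (c u))).clm_apply
      (hasFDerivAt_const B (c u))
    rw [HasFDerivAt.fderiv (f := fun y ↦ L.metric.inChart (L.curve u) y A B) h1]
    simp
  have hfin := hgeo W
  rw [hder.self_of_nhds, hder2, LorentzMetric.christoffel, hGd, hGd]
  rw [hθu] at hfin
  change G (c u) _ _ + _ = 0
  change _ + (fderiv ℝ G (c u) (fderiv ℝ θ x₀ (1, 0, 0)) (fderiv ℝ θ x₀ (1, 0, 0)) _ +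
    fderiv ℝ G (c u) (fderiv ℝ θ x₀ (1, 0, 0)) (fderiv ℝ θ x₀ (1, 0, 0)) _ -
    fderiv ℝ G (c u) _ (fderiv ℝ θ x₀ (1, 0, 0)) (fderiv ℝ θ x₀ (1, 0, 0))) / 2 = 0
  linarith

theorem isGeodesicOn_curve (hγ : IsGeodesicOn g γ I) : IsGeodesicOn L.metric L.curve I where
  isOpen := hγ.isOpen
  ordConnected := hγ.ordConnected
  nonempty := hγ.nonempty
  smooth := fun _ hu ↦ (L.contMDiffAt_curve hu).contMDiffWithinAt
  velocity_ne_zero := fun _ hu ↦ L.velocity_curve_ne_zero hu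
  geodesic_eq := fun _ hu Z ↦ L.geodesic_eq_curve hu Z

end PenroseLimit

/-! ### Reparametrized orbits and the conclusion. -/

theorem injective_of_deriv_ne_zero {τ : ℝ → ℝ} (hτ : Continuous τ) (hd : ∀ s, deriv τ s ≠ 0) :
    Function.Injective τ := by
  intro a b hab
  by_contra hne
  wlog hlt : a < b generalizing a b
  · exact this hab.symm (Ne.symm hne) (lt_of_le_of_ne (not_lt.1 hlt) (Ne.symm hne))
  obtain ⟨c, -, hc⟩ := exists_deriv_eq_zero hlt hτ.continuousOn hab
  exact hd c hc

/-- A map with nonvanishing derivative is open by the inverse function theorem, and the inverse of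
an injective open map is continuous on the range. -/
theorem continuousOn_invFun_of_deriv_ne_zero {τ : ℝ → ℝ} (hτ : ContDiff ℝ ∞ τ)
    (hd : ∀ s, deriv τ s ≠ 0) : ContinuousOn (Function.invFun τ) (range τ) := by
  have hinj := injective_of_deriv_ne_zero hτ.continuous hd
  have hopen : IsOpenMap τ := isOpenMap_of_hasStrictDerivAt (f' := deriv τ)
    (fun s ↦ hτ.contDiffAt.hasStrictDerivAt (by simp)) hd
  rintro _ ⟨s, rfl⟩
  refine ContinuousAt.continuousWithinAt ?_
  rw [ContinuousAt, Function.leftInverse_invFun hinj s,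
    ← hopen.map_nhds_eq hτ.continuous.continuousAt]
  exact tendsto_map'_iff.2 (tendsto_id.congr fun t ↦ (Function.leftInverse_invFun hinj t).symm)

section

variable {m : ℕ} {M : Type*} [TopologicalSpace M] [ChartedSpace (SpacetimeModel m) M]
  [IsManifold 𝓘(ℝ, SpacetimeModel m) ∞ M]
  {g : LorentzMetric m M} {γ : ℝ → M} {I : Set ℝ}

/-- The reparametrization of an orbit turns translations of the group parameter into a flow on the
parameters of the orbit. -/
theorem isAxisFlow_of_orbit (hI : IsOpen I) {φ : ℝ → M → M}
    (hφ : IsOneParameterIsometryGroup g φ) {τ : ℝ → ℝ} (hτ : ContDiff ℝ ∞ τ)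
    (hd : ∀ s, deriv τ s ≠ 0) (hrange : range τ = I) (horbit : ∀ s, γ (τ s) = φ s (γ (τ 0))) :
    IsAxisFlow g γ I φ (fun s u ↦ τ (s + Function.invFun τ u)) := by
  have hinv := Function.leftInverse_invFun (injective_of_deriv_ne_zero hτ.continuous hd)
  refine ⟨hφ, hI, fun s u _ ↦ hrange ▸ mem_range_self _, ?_, ?_, ?_, ?_⟩
  · rw [← hrange]
    rintro _ ⟨r, rfl⟩
    simp only [hinv r, zero_add]
  · intro s t u _
    simp only [hinv (t + Function.invFun τ u), add_assoc]
  · refine hτ.continuous.comp_continuousOn (continuous_fst.continuousOn.add ?_)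
    refine (continuousOn_invFun_of_deriv_ne_zero hτ hd).comp continuous_snd.continuousOn ?_
    rintro z ⟨-, hz⟩
    rwa [hrange]
  · rw [← hrange]
    rintro s _ ⟨r, rfl⟩
    simp only [hinv r]
    rw [horbit r, horbit (s + r), hφ.add]

variable {N : Type*} [TopologicalSpace N] [ChartedSpace (SpacetimeModel m) N]
  [IsManifold 𝓘(ℝ, SpacetimeModel m) ∞ N] {ι : Type*}

/-- If the curve `γ` is an orbit of a one-parameter group of isometries, so is the corresponding
curve in the Penrose limit, with the same parametrization. -/
theorem PenroseLimit.exists_orbit (L : PenroseLimit g γ I ι N) (hI : IsOpen I) {φ : ℝ → M → M}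
    (hφ : IsOneParameterIsometryGroup g φ) {τ : ℝ → ℝ} (hτ : ContDiff ℝ ∞ τ)
    (hd : ∀ s, deriv τ s ≠ 0) (hrange : range τ = I) (horbit : ∀ s, γ (τ s) = φ s (γ (τ 0))) :
    ∃ Φ : ℝ → N → N, IsOneParameterIsometryGroup L.metric Φ ∧
      ∀ s, L.curve (τ s) = Φ s (L.curve (τ 0)) := by
  have h := isAxisFlow_of_orbit hI hφ hτ hd hrange horbit
  refine ⟨_, L.isOneParameterIsometryGroup_flow h, fun s ↦ ?_⟩
  rw [L.flow_curve h s (hrange ▸ mem_range_self 0), Function.leftInverse_invFun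
    (injective_of_deriv_ne_zero hτ.continuous hd) 0, add_zero]

end

theorem mainTheorem5 {m : ℕ}
    {M : Type*} [TopologicalSpace M] [T2Space M] [SecondCountableTopology M]
    [ChartedSpace (SpacetimeModel m) M] [IsManifold 𝓘(ℝ, SpacetimeModel m) ∞ M]
    {N : Type*} [TopologicalSpace N] [T2Space N] [SecondCountableTopology N]
    [ChartedSpace (SpacetimeModel m) N] [IsManifold 𝓘(ℝ, SpacetimeModel m) ∞ N]
    (g : LorentzMetric m M) (γ : ℝ → M) (I : Set ℝ) (hγ : IsNullGeodesicOn g γ I)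
    {ι : Type*} (L : PenroseLimit g γ I ι N) :
    (IsHomogeneousGeodesic g γ I → IsHomogeneousGeodesic L.metric L.curve I) ∧
    (IsAbsolutelyHomogeneousGeodesic g γ I →
      IsAbsolutelyHomogeneousGeodesic L.metric L.curve I) := by
  have hL := L.isGeodesicOn_curve hγ.toIsGeodesicOn
  refine ⟨?_, ?_⟩
  · rintro ⟨-, φ, hφ, τ, hτ, hd, hrange, horbit⟩
    obtain ⟨Φ, hΦ, hΦorbit⟩ := L.exists_orbit hγ.isOpen hφ hτ hd hrange horbit
    exact ⟨hL, Φ, hΦ, τ, hτ, hd, hrange, hΦorbit⟩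
  · rintro ⟨-, hI, φ, hφ, horbit⟩
    -- The absolute case is the parametrization `τ = id`, whose range is `I = ℝ`.
    obtain ⟨Φ, hΦ, hΦorbit⟩ := L.exists_orbit (τ := id) hγ.isOpen hφ contDiff_id (by simp)
      (by rw [hI, range_id]) horbit
    exact ⟨hL, hI, Φ, hΦ, hΦorbit⟩
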